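/- All graphs are finite, simple and undirected. The repetition number $\mathrm{rep}(G)$ of a graph $G$ is the maximum multiplicity of a vertex degree in $G$ (and $0$ for the graph without vertices). For a positive integer $k$, let $C(k)$ be the least integer such that, for every $n$, every $n$-vertex graph has an induced subgraph with at least $n-C(k)$ vertices whose repetition number is at least $\min\{k,\,n-C(k)\}$. Theorem. For every graph $G$ with at least $5$ vertices there is a set of at most $3$ vertices of $G$ such that the induced subgraph obtained by deleting it has at least three vertices of the same degree (degrees being taken in that subgraph). Moreover, $C(3)=3$. -/

import Mathlib

open Classical in
/-- The repetition number of a finite graph: the maximum multiplicity of a vertex degree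
(it is `0` for the graph without vertices). -/
noncomputable def repNumber {V : Type*} [Fintype V] (G : SimpleGraph V) : ℕ :=
  Finset.univ.sup fun v : V => (Finset.univ.filter fun w : V => G.degree w = G.degree v).card

/-- Every graph on `n` vertices, for every `n`, has an induced subgraph with at least `n - c`
vertices whose repetition number is at least `min k (n - c)`. Truncated subtraction is harmless:
for `n ≤ c` both bounds are vacuous, as they are over the integers. -/
def RepeatsAfterDeleting (k c : ℕ) : Prop :=
  ∀ (n : ℕ) (G : SimpleGraph (Fin n)), ∃ W : Finset (Fin n),
    n - c ≤ W.card ∧ min k (n - c) ≤ repNumber (G.induce (W : Set (Fin n)))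

/-- `IsC k m` says that `m` is the number `C(k)`: the least integer `c` with
`RepeatsAfterDeleting k c`. -/
def IsC (k m : ℕ) : Prop :=
  IsLeast {c : ℕ | RepeatsAfterDeleting k c} m

/-! Suppose that deleting at most three vertices never leaves three equal degrees (`RepFree`). Then
three vertices of close degrees are rigid: outside vertices that see only those of larger degree
could be deleted to close the gaps, so few exist. For successive gaps of at most one, not both zero,
neighbourhoods nearly coincide (`nearTwin_zero_one`, `nearTwin_one_zero`, `nearTwin_one_one`).
Playing overlapping triples against each other excludes most gap sequences of five vertices whose
degrees spread over at most three. The gaps 0, 1, 2, 0 and 1, 0, 2, 0 resist; they lead to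
infeasible integer linear systems in the numbers of outside vertices of each adjacency type.
Complementation preserves `RepFree` and reverses gap sequences, which covers the rest. Hence the
degrees of any five vertices spread over at least four (`add_three_lt_degree`).

So, in degree order, moving up by 4k places raises the degree by at least 4k. Degrees lie between 0
and n - 1, and these two values exclude each other, which leaves almost no slack when n is at least
5. The few tight configurations fail because isolated, pendant, dominating and almost dominating
vertices have nearly prescribed adjacencies (`card_lt_five`).

This gives C(3) ≤ 3, graphs with at most four vertices being trivial. The lower bound comes from a
graph on eight vertices, checked by evaluation. -/

namespace SimpleGraph

set_option linter.unusedSectionVars false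

/-! ### Degree differences and private neighbours -/

variable {V : Type*} [Fintype V] [DecidableEq V] (G : SimpleGraph V) [DecidableRel G.Adj]

/-- No deletion of at most three vertices leaves three vertices of the same degree. -/
def RepFree : Prop :=
  ∀ (D : Finset V) (a b c : V), a ≠ b → a ≠ c → b ≠ c → a ∉ D → b ∉ D → c ∉ D → D.card ≤ 3 →
    G.degree a + (D.filter (G.Adj b)).card = G.degree b + (D.filter (G.Adj a)).card →
    G.degree b + (D.filter (G.Adj c)).card = G.degree c + (D.filter (G.Adj b)).card → False

/-- The number of vertices outside `S` adjacent to `u` but not to `v`. -/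
def outDiff (S : Finset V) (u v : V) : ℕ := (Sᶜ.filter fun w => G.Adj u w ∧ ¬ G.Adj v w).card

/-- `hi` and `lo` have the same neighbours, except that `z` is adjacent to `hi` only. -/
def NearTwin (lo hi z : V) : Prop :=
  G.Adj z hi ∧ ¬ G.Adj z lo ∧ ∀ w, w ≠ lo → w ≠ hi → w ≠ z → (G.Adj w lo ↔ G.Adj w hi)

/-- `c` has the same neighbours as `a`, and also `b` and one further vertex. -/
def NearTwinTwo (a b c : V) : Prop :=
  G.Adj b c ∧ ¬ G.Adj a b ∧ ∃ x, x ≠ a ∧ x ≠ b ∧ x ≠ c ∧ G.Adj x c ∧ ¬ G.Adj x a ∧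
    ∀ w, w ≠ a → w ≠ b → w ≠ c → w ≠ x → (G.Adj w a ↔ G.Adj w c)

variable {G}

/-- Common neighbours outside `S` cancel from the difference of the two degrees. Everything is kept
additive to avoid truncated subtraction. -/
theorem degree_add_outDiff (S : Finset V) (u v : V) :
    G.degree u + G.outDiff S v u + (S.filter (G.Adj v)).card =
      G.degree v + G.outDiff S u v + (S.filter (G.Adj u)).card := by
  have key : ∀ a b : V, G.degree a = (Sᶜ.filter fun w => G.Adj a w ∧ G.Adj b w).card +
      G.outDiff S a b + (S.filter (G.Adj a)).card := by
    intro a b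
    have h1 : G.degree a = (Finset.univ.filter (G.Adj a)).card := by
      rw [← G.card_neighborFinset_eq_degree, G.neighborFinset_eq_filter]
    have h2 : (Finset.univ.filter (G.Adj a)) = Sᶜ.filter (G.Adj a) ∪ S.filter (G.Adj a) := by
      ext w; by_cases hw : w ∈ S <;> simp [hw]
    have h3 : Disjoint (Sᶜ.filter (G.Adj a)) (S.filter (G.Adj a)) :=
      Finset.disjoint_filter_filter disjoint_compl_left
    rw [h1, h2, Finset.card_union_of_disjoint h3,
      ← Finset.card_filter_add_card_filter_not (s := Sᶜ.filter (G.Adj a)) (G.Adj b),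
      Finset.filter_filter, Finset.filter_filter]
    rfl
  have h1 := key u v
  have h2 := key v u
  have h3 : (Sᶜ.filter fun w => G.Adj v w ∧ G.Adj u w) =
      Sᶜ.filter fun w => G.Adj u w ∧ G.Adj v w := by
    ext w; simp [and_comm]
  rw [h3] at h2
  omega

theorem outDiff_eq_zero {S : Finset V} {u v : V} :
    G.outDiff S u v = 0 ↔ ∀ w, w ∉ S → G.Adj u w → G.Adj v w := by
  simp [outDiff, Finset.filter_eq_empty_iff]

/-- Adjacency as a number. -/
def adjNat (G : SimpleGraph V) [DecidableRel G.Adj] (u v : V) : ℕ := if G.Adj u v then 1 else 0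

theorem adjNat_comm (u v : V) : G.adjNat u v = G.adjNat v u := by simp [adjNat, G.adj_comm]

theorem adjNat_of_adj {u v : V} (h : G.Adj u v) : G.adjNat u v = 1 := by simp [adjNat, h]

theorem adjNat_of_not_adj {u v : V} (h : ¬ G.Adj u v) : G.adjNat u v = 0 := by simp [adjNat, h]

theorem card_filter_insert {D : Finset V} {x : V} (hx : x ∉ D) (u : V) :
    ((insert x D).filter (G.Adj u)).card = G.adjNat u x + (D.filter (G.Adj u)).card := by
  rw [Finset.filter_insert]
  split_ifs with h
  · rw [Finset.card_insert_of_notMem (by simp [hx]), adjNat_of_adj h, add_comm]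
  · rw [adjNat_of_not_adj h, zero_add]

theorem degree_add_outDiff_triple {a b c : V} (hab : a ≠ b) (hac : a ≠ c) (hbc : b ≠ c) (u v : V) :
    G.degree u + G.outDiff {a, b, c} v u + (G.adjNat v a + G.adjNat v b + G.adjNat v c) =
      G.degree v + G.outDiff {a, b, c} u v + (G.adjNat u a + G.adjNat u b + G.adjNat u c) := by
  have h := degree_add_outDiff (G := G) {a, b, c} u v
  have key : ∀ x, (({a, b, c} : Finset V).filter (G.Adj x)).card =
      G.adjNat x a + G.adjNat x b + G.adjNat x c := by
    intro x
    rw [card_filter_insert (by simp [hab, hac]), card_filter_insert (by simp [hbc]),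
      ← insert_empty_eq c, card_filter_insert (by simp)]
    simp [add_assoc]
  rw [key, key] at h
  exact h

/-! ### Complements and deletions of few vertices -/

namespace RepFree

/-- A vertex of degree k in G - D has degree n - |D| - 1 - k in the complement of G - D, so ties are
preserved. -/
theorem compl (hG : G.RepFree) : Gᶜ.RepFree := by
  intro D a b c hab hac hbc ha hb hc hD h1 h2
  have key : ∀ x, x ∉ D → (D.filter (Gᶜ.Adj x)).card + (D.filter (G.Adj x)).card = D.card := by
    intro x hx
    rw [← Finset.card_filter_add_card_filter_not (s := D) (G.Adj x), add_comm]
    congr 2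
    ext w
    simp only [Finset.mem_filter, compl_adj]
    constructor
    · rintro ⟨h, _, h'⟩; exact ⟨h, h'⟩
    · rintro ⟨h, h'⟩; exact ⟨h, fun e => hx (e ▸ h), h'⟩
  have ka := key a ha
  have kb := key b hb
  have kc := key c hc
  have dlt : ∀ x, G.degree x < Fintype.card V := fun x => G.degree_lt_card_verts x
  have da := dlt a
  have db := dlt b
  have dc := dlt c
  rw [degree_compl, degree_compl] at h1 h2
  exact hG D a b c hab hac hbc ha hb hc hD (by omega) (by omega)

theorem not_zero (hG : G.RepFree) {a b c : V} (hab : a ≠ b) (hac : a ≠ c) (hbc : b ≠ c)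
    (h1 : G.degree a = G.degree b) (h2 : G.degree b = G.degree c) : False :=
  hG ∅ a b c hab hac hbc (by simp) (by simp) (by simp) (by simp) (by simpa) (by simpa)

/-- This and the next two lemmas turn a deletion into linear arithmetic in `adjNat`, so that later
deletion arguments end in `omega`. -/
theorem not_one (hG : G.RepFree) {a b c x : V} (hab : a ≠ b) (hac : a ≠ c) (hbc : b ≠ c)
    (hxa : x ≠ a) (hxb : x ≠ b) (hxc : x ≠ c)
    (h1 : G.degree a + G.adjNat b x = G.degree b + G.adjNat a x)
    (h2 : G.degree b + G.adjNat c x = G.degree c + G.adjNat b x) : False := by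
  refine hG {x} a b c hab hac hbc (by grind) (by grind) (by grind) (by simp) ?_ ?_ <;>
  · rw [← insert_empty_eq x]
    simp only [card_filter_insert (Finset.notMem_empty x)]
    simpa

theorem not_two (hG : G.RepFree) {a b c x y : V} (hab : a ≠ b) (hac : a ≠ c) (hbc : b ≠ c)
    (hxa : x ≠ a) (hxb : x ≠ b) (hxc : x ≠ c) (hya : y ≠ a) (hyb : y ≠ b) (hyc : y ≠ c)
    (hxy : x ≠ y)
    (h1 : G.degree a + G.adjNat b x + G.adjNat b y = G.degree b + G.adjNat a x + G.adjNat a y)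
    (h2 : G.degree b + G.adjNat c x + G.adjNat c y = G.degree c + G.adjNat b x + G.adjNat b y) :
    False := by
  refine hG {x, y} a b c hab hac hbc (by grind) (by grind) (by grind)
    (by rw [Finset.card_pair hxy]; omega) ?_ ?_ <;>
  · rw [← insert_empty_eq y]
    simp only [card_filter_insert (Finset.notMem_empty y),
      card_filter_insert (show x ∉ insert y ∅ by simpa)]
    simp
    omega

theorem not_three (hG : G.RepFree) {a b c x y z : V} (hab : a ≠ b) (hac : a ≠ c) (hbc : b ≠ c)
    (hxa : x ≠ a) (hxb : x ≠ b) (hxc : x ≠ c) (hya : y ≠ a) (hyb : y ≠ b) (hyc : y ≠ c)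
    (hza : z ≠ a) (hzb : z ≠ b) (hzc : z ≠ c) (hxy : x ≠ y) (hxz : x ≠ z) (hyz : y ≠ z)
    (h1 : G.degree a + G.adjNat b x + G.adjNat b y + G.adjNat b z =
      G.degree b + G.adjNat a x + G.adjNat a y + G.adjNat a z)
    (h2 : G.degree b + G.adjNat c x + G.adjNat c y + G.adjNat c z =
      G.degree c + G.adjNat b x + G.adjNat b y + G.adjNat b z) :
    False := by
  refine hG {x, y, z} a b c hab hac hbc (by grind) (by grind) (by grind)
    (by rw [Finset.card_eq_three.2 ⟨x, y, z, hxy, hxz, hyz, rfl⟩]) ?_ ?_ <;>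
  · rw [← insert_empty_eq z]
    simp only [card_filter_insert (Finset.notMem_empty z),
      card_filter_insert (show y ∉ insert z ∅ by simpa),
      card_filter_insert (show x ∉ insert y (insert z ∅) by simp [hxy, hxz])]
    simp
    omega

end RepFree

/-! ### Near twins among three vertices of close degrees -/

theorem adjNat_self (u : V) : G.adjNat u u = 0 := by simp [adjNat]

theorem adjNat_le_one (u v : V) : G.adjNat u v ≤ 1 := by unfold adjNat; split_ifs <;> omega

theorem adjNat_eq_one {u v : V} : G.adjNat u v = 1 ↔ G.Adj u v := by simp [adjNat]

theorem adjNat_eq_zero {u v : V} : G.adjNat u v = 0 ↔ ¬ G.Adj u v := by simp [adjNat]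

theorem outDiff_triple_eq_zero {a b c u v : V} :
    G.outDiff {a, b, c} u v = 0 ↔
      ∀ w, w ≠ a → w ≠ b → w ≠ c → G.Adj u w → G.Adj v w := by
  rw [outDiff_eq_zero]
  simp only [Finset.mem_insert, Finset.mem_singleton, not_or, and_imp]

/-- Outside the triple `b` gains nothing over `a`, and a possible edge between them counts for both.
The excess of `b` must come from `c`, which contributes at most one, so no outside vertex is private
to `a`. -/
theorem nearTwin_of_imp {a b c : V} (hab : a ≠ b) (hac : a ≠ c) (hbc : b ≠ c)
    (h : ∀ w, w ≠ a → w ≠ b → w ≠ c → G.Adj b w → G.Adj a w) (hd : G.degree a < G.degree b) :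
    G.NearTwin a b c := by
  have e := degree_add_outDiff_triple (G := G) hab hac hbc a b
  rw [← outDiff_triple_eq_zero] at h
  have hs := adjNat_self (G := G) a
  have hs' := adjNat_self (G := G) b
  have h1 := adjNat_le_one (G := G) b c
  have h2 := adjNat_comm (G := G) a b
  have h3 : G.adjNat b c = 1 := by omega
  have h4 : G.adjNat a c = 0 := by omega
  have h5 : G.outDiff {a, b, c} a b = 0 := by omega
  rw [outDiff_triple_eq_zero] at h h5
  rw [adjNat_eq_one] at h3
  rw [adjNat_eq_zero] at h4
  exact ⟨h3.symm, fun h => h4 h.symm, fun w hwa hwb hwc =>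
    ⟨fun h' => (h5 w hwa hwb hwc h'.symm).symm, fun h' => (h w hwa hwb hwc h'.symm).symm⟩⟩

/-- Three vertices of degrees `d, d, d + 1`. -/
theorem RepFree.nearTwin_zero_one (hG : G.RepFree) {a b c : V} (hab : a ≠ b) (hac : a ≠ c)
    (hbc : b ≠ c) (h1 : G.degree a = G.degree b) (h2 : G.degree c = G.degree b + 1) :
    G.NearTwin b c a ∨ G.NearTwin a c b := by
  -- A vertex seen by `c` only could be deleted to equalise the degrees.
  have hA : ∀ w, w ≠ a → w ≠ b → w ≠ c → ¬ G.Adj a w → ¬ G.Adj b w → G.Adj c w → False := by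
    intro w hwa hwb hwc ha hb hc
    refine hG.not_one hab hac hbc hwa hwb hwc ?_ ?_ <;>
      simp only [adjNat, ha, hb, hc, if_true, if_false] <;> omega
  -- A vertex seen by `b, c` only and one seen by `a, c` only cannot coexist: deleting both costs
  -- `a, b, c` the amounts 1, 1, 2. One kind is missing, so `b` or `a` sees all outside neighbours
  -- of `c`.
  by_cases hB : ∃ w, w ≠ a ∧ w ≠ b ∧ w ≠ c ∧ ¬ G.Adj a w ∧ G.Adj b w ∧ G.Adj c w
  · obtain ⟨x, xa, xb, xc, hxa, hxb, hxc⟩ := hB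
    left
    refine nearTwin_of_imp hbc hab.symm hac.symm (fun w wb wc wa hwc => ?_) (by omega)
    by_contra hwb
    by_cases hwa : G.Adj a w
    · refine hG.not_two hab hac hbc xa xb xc wa wb wc (by grind) ?_ ?_ <;>
      simp only [adjNat, hxa, hxb, hxc, hwa, hwb, hwc, if_true, if_false] <;> omega
    · exact hA w wa wb wc hwa hwb hwc
  · right
    refine nearTwin_of_imp hac hab hbc.symm (fun w wa wc wb hwc => ?_) (by omega)
    by_contra hwa
    by_cases hwb : G.Adj b w
    · exact hB ⟨w, wa, wb, wc, hwa, hwb, hwc⟩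
    · exact hA w wa wb wc hwa hwb hwc

/-- Three vertices of degrees `d, d + 1, d + 1`. -/
theorem RepFree.nearTwin_one_zero (hG : G.RepFree) {a b c : V} (hab : a ≠ b) (hac : a ≠ c)
    (hbc : b ≠ c) (h1 : G.degree b = G.degree a + 1) (h2 : G.degree c = G.degree b) :
    G.NearTwin a b c ∨ G.NearTwin a c b := by
  -- Complementing swaps the high and the low vertex of a near-twin pair.
  have key : ∀ b c, a ≠ b → a ≠ c → b ≠ c → Gᶜ.NearTwin b a c → G.NearTwin a b c := by
    rintro b c hab hac hbc ⟨h1, h2, h3⟩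
    refine ⟨?_, ?_, fun w hwa hwb hwc => ?_⟩
    · simp only [compl_adj] at h2
      grind [G.adj_comm]
    · simp only [compl_adj] at h1
      exact h1.2
    · have := h3 w hwb hwa hwc
      simp only [compl_adj] at this
      grind
  have hb := degree_compl G b
  have hc := degree_compl G c
  have ha := degree_compl G a
  have := G.degree_lt_card_verts b
  have := hG.compl.nearTwin_zero_one hbc hab.symm hac.symm (by omega) (by omega)
  rcases this with h | h
  · exact Or.inr (key c b hac hab hbc.symm h)
  · exact Or.inl (key b c hab hac hbc h)

/-- Three vertices of degrees `d, d + 1, d + 2`. -/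
theorem RepFree.nearTwin_one_one (hG : G.RepFree) {a b c : V} (hab : a ≠ b) (hac : a ≠ c)
    (hbc : b ≠ c) (h1 : G.degree b = G.degree a + 1) (h2 : G.degree c = G.degree b + 1) :
    G.NearTwin a b c ∨ G.NearTwin b c a ∨ G.NearTwinTwo a b c := by
  -- One vertex of each kind would cost `a, b, c` exactly their excess 0, 1, 2.
  have hAB : (∀ w, w ≠ a → w ≠ b → w ≠ c → ¬ G.Adj a w → ¬ G.Adj b w → G.Adj c w → False) ∨
      (∀ w, w ≠ a → w ≠ b → w ≠ c → ¬ G.Adj a w → G.Adj b w → G.Adj c w → False) := by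
    by_contra! h
    obtain ⟨⟨x, xa, xb, xc, hxa, hxb, hxc, -⟩, ⟨y, ya, yb, yc, hya, hyb, hyc, -⟩⟩ := h
    refine hG.not_two hab hac hbc xa xb xc ya yb yc (by grind) ?_ ?_ <;>
      simp only [adjNat, hxa, hxb, hxc, hya, hyb, hyc, if_true, if_false] <;> omega
  have eac := degree_add_outDiff_triple (G := G) hab hac hbc a c
  have eab := degree_add_outDiff_triple (G := G) hab hac hbc a b
  have ebc := degree_add_outDiff_triple (G := G) hab hac hbc b c
  have s1 := adjNat_self (G := G) a
  have s2 := adjNat_self (G := G) b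
  have s3 := adjNat_self (G := G) c
  have c1 := adjNat_comm (G := G) a b
  have c2 := adjNat_comm (G := G) a c
  have c3 := adjNat_comm (G := G) b c
  have l1 := adjNat_le_one (G := G) a b
  have l2 := adjNat_le_one (G := G) a c
  have l3 := adjNat_le_one (G := G) b c
  by_cases htwo : 2 ≤ G.outDiff {a, b, c} c a
  · obtain ⟨x, hx, y, hy, hxy⟩ := Finset.one_lt_card.1 htwo
    simp only [Finset.mem_filter, Finset.mem_compl, Finset.mem_insert, Finset.mem_singleton,
      not_or] at hx hy
    obtain ⟨⟨xa, xb, xc⟩, hxc, hxa⟩ := hx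
    obtain ⟨⟨ya, yb, yc⟩, hyc, hya⟩ := hy
    -- By `hAB`, `x` and `y` are of one kind. If `b` sees both, a vertex seen by `a, c` only
    -- completes a deletion with costs 1, 2, 3; if `b` sees neither, a vertex seen by `b` only gives
    -- costs 0, 1, 2.
    rcases hAB with hA | hB
    · right; left
      have hxb : G.Adj b x := by
        by_contra h; exact hA x xa xb xc hxa h hxc
      have hyb : G.Adj b y := by
        by_contra h; exact hA y ya yb yc hya h hyc
      suffices h : ∀ w, w ≠ a → w ≠ b → w ≠ c → G.Adj c w → G.Adj b w by
        exact nearTwin_of_imp hbc hab.symm hac.symm (fun w wb wc wa => h w wa wb wc) (by omega)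
      intro w wa wb wc hwc
      by_contra hwb
      by_cases hwa : G.Adj a w
      · refine hG.not_three hab hac hbc xa xb xc ya yb yc wa wb wc hxy
          (by grind) (by grind) ?_ ?_ <;>
        simp only [adjNat, hxa, hxb, hxc, hya, hyb, hyc, hwa, hwb, hwc, if_true, if_false] <;> omega
      · exact hA w wa wb wc hwa hwb hwc
    · left
      have hxb : ¬ G.Adj b x := fun h => hB x xa xb xc hxa h hxc
      have hyb : ¬ G.Adj b y := fun h => hB y ya yb yc hya h hyc
      refine nearTwin_of_imp hab hac hbc (fun w wa wb wc hwb => ?_) (by omega)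
      by_contra hwa
      by_cases hwc : G.Adj c w
      · exact hB w wa wb wc hwa hwb hwc
      · refine hG.not_three hab hac hbc xa xb xc ya yb yc wa wb wc hxy
          (by grind) (by grind) ?_ ?_ <;>
        simp only [adjNat, hxa, hxb, hxc, hya, hyb, hyc, hwa, hwb, hwc, if_true, if_false] <;> omega
  · right; right
    -- With at most one outside neighbour private to `c` against `a`, a gap of two needs both that
    -- neighbour and `b`.
    have h3 : G.adjNat b c = 1 := by omega
    have h4 : G.adjNat a b = 0 := by omega
    have h5 : G.outDiff {a, b, c} a c = 0 := by omega
    have h6 : G.outDiff {a, b, c} c a = 1 := by omega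
    rw [adjNat_eq_one] at h3
    rw [adjNat_eq_zero] at h4
    rw [outDiff_triple_eq_zero] at h5
    obtain ⟨x, hx⟩ := Finset.card_eq_one.1 h6
    have hx' : ∀ w, w = x ↔ (w ≠ a ∧ w ≠ b ∧ w ≠ c) ∧ G.Adj c w ∧ ¬ G.Adj a w := by
      intro w
      rw [← Finset.mem_singleton, ← hx]
      simp
    obtain ⟨⟨xa, xb, xc⟩, hxc, hxa⟩ := (hx' x).1 rfl
    refine ⟨h3, h4, x, xa, xb, xc, hxc.symm, fun h => hxa h.symm, fun w wa wb wc wx => ?_⟩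
    have := hx' w
    have := h5 w wa wb wc
    grind [G.adj_comm]

/-! ### Gap sequences excluded by near twins -/

namespace RepFree

/-- The lower triple makes the tied vertices `b, c` adjacent, the upper triple makes them
nonadjacent. -/
theorem not_one_zero_one (hG : G.RepFree) {a b c d : V} (hab : a ≠ b) (hac : a ≠ c)
    (hbc : b ≠ c) (hbd : b ≠ d) (hcd : c ≠ d) (h1 : G.degree b = G.degree a + 1)
    (h2 : G.degree c = G.degree b) (h3 : G.degree d = G.degree c + 1) : False := by
  have hb : G.Adj b c := by
    rcases hG.nearTwin_one_zero hab hac hbc h1 h2 with h | h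
    · exact h.1.symm
    · exact h.1
  rcases hG.nearTwin_zero_one hbc hbd hcd h2.symm h3 with h | h
  · exact h.2.1 hb
  · exact h.2.1 hb.symm

/-- Degrees `d, d, d + 1, d + 1`. -/
theorem zero_one_zero (hG : G.RepFree) {a b c d : V} (hab : a ≠ b) (hac : a ≠ c) (had : a ≠ d)
    (hbc : b ≠ c) (hbd : b ≠ d) (hcd : c ≠ d) (h1 : G.degree b = G.degree a)
    (h2 : G.degree c = G.degree b + 1) (h3 : G.degree d = G.degree c) :
    ¬ G.Adj a b ∧ G.Adj c d ∧ ((G.Adj a d ∧ G.Adj b c ∧ ¬ G.Adj a c ∧ ¬ G.Adj b d ∧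
        ∀ w, w ≠ a → w ≠ b → w ≠ c → w ≠ d → (G.Adj w a ↔ G.Adj w c) ∧ (G.Adj w b ↔ G.Adj w c) ∧
        (G.Adj w d ↔ G.Adj w c)) ∨
      (G.Adj a c ∧ G.Adj b d ∧ ¬ G.Adj a d ∧ ¬ G.Adj b c ∧
        ∀ w, w ≠ a → w ≠ b → w ≠ c → w ≠ d → (G.Adj w a ↔ G.Adj w c) ∧ (G.Adj w b ↔ G.Adj w c) ∧
        (G.Adj w d ↔ G.Adj w c))) := by
  -- The alternative taken by the first triple decides which matching joins `a, b` to `c, d`; the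
  -- near-twin relations then make all four look alike from outside.
  have t1 := hG.nearTwin_zero_one hab hac hbc h1.symm h2
  have t2 := hG.nearTwin_zero_one hab had hbd h1.symm (by omega)
  have t3 := hG.nearTwin_one_zero hac had hcd (by omega) h3
  have t4 := hG.nearTwin_one_zero hbc hbd hcd (by omega) h3
  rcases t1 with ⟨p1, p2, p3⟩ | ⟨p1, p2, p3⟩
  · obtain ⟨q1, q2, q3⟩ : G.NearTwin a d b := by
      rcases t2 with h | h
      · rcases t3 with ⟨e1, e2, e3⟩ | ⟨e1, e2, e3⟩
        · exact absurd h.1.symm e2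
        · exact absurd p1.symm e2
      · exact h
    have p4 := p3 d hbd.symm hcd.symm had.symm
    have hcd' : G.Adj c d := (p4.1 q1.symm).symm
    obtain ⟨r1, r2, r3⟩ : G.NearTwin a c d := by
      rcases t3 with h | h
      · exact h
      · exact absurd p1.symm h.2.1
    refine ⟨p2, hcd', Or.inr ⟨p1, q1, fun h => r2 h.symm,
      fun h => p2 ((r3 b hab.symm hbc hbd).2 h).symm, fun w wa wb wc wd => ?_⟩⟩
    exact ⟨r3 w wa wc wd, p3 w wb wc wa, (q3 w wa wd wb).symm.trans (r3 w wa wc wd)⟩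
  · obtain ⟨q1, q2, q3⟩ : G.NearTwin b d a := by
      rcases t2 with h | h
      · exact h
      · rcases t4 with ⟨e1, e2, e3⟩ | ⟨e1, e2, e3⟩
        · exact absurd h.1.symm e2
        · exact absurd p1.symm e2
    have p4 := p3 d had.symm hcd.symm hbd.symm
    have hcd' : G.Adj c d := (p4.1 q1.symm).symm
    obtain ⟨r1, r2, r3⟩ : G.NearTwin b c d := by
      rcases t4 with h | h
      · exact h
      · exact absurd p1.symm h.2.1
    refine ⟨q2, hcd', Or.inl ⟨q1, p1,
      fun h => p2 ((r3 a hab hac had).2 h).symm, fun h => r2 h.symm, fun w wa wb wc wd => ?_⟩⟩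
    exact ⟨p3 w wa wc wb, r3 w wb wc wd, (q3 w wb wd wa).symm.trans (r3 w wb wc wd)⟩

/-- Degrees `d, d, d + 1, d + 2`. -/
theorem zero_one_one (hG : G.RepFree) {a b c d : V} (hab : a ≠ b) (hac : a ≠ c) (had : a ≠ d)
    (hbc : b ≠ c) (hbd : b ≠ d) (hcd : c ≠ d) (h1 : G.degree b = G.degree a)
    (h2 : G.degree c = G.degree b + 1) (h3 : G.degree d = G.degree c + 1) :
    ¬ G.Adj a b ∧ G.Adj c d ∧ ((G.Adj a d ∧ G.Adj b c ∧ ¬ G.Adj a c ∧ ¬ G.Adj b d) ∨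
      (G.Adj a c ∧ G.Adj b d ∧ ¬ G.Adj a d ∧ ¬ G.Adj b c)) := by
  have t1 := hG.nearTwin_zero_one hab hac hbc h1.symm h2
  have t3 := hG.nearTwin_one_one hac had hcd (by omega) h3
  have t4 := hG.nearTwin_one_one hbc hbd hcd (by omega) h3
  simp only [NearTwin, NearTwinTwo] at t1 t3 t4
  grind [G.adj_comm]

/-- The lower vertices make `c` adjacent to both `d` and `e`, while the triple `c, d, e` forbids one
of these edges. -/
theorem not_zero_one_one_zero (hG : G.RepFree) {a b c d e : V} (hab : a ≠ b) (hac : a ≠ c)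
    (had : a ≠ d) (hae : a ≠ e) (hbc : b ≠ c) (hbd : b ≠ d) (hbe : b ≠ e) (hcd : c ≠ d)
    (hce : c ≠ e) (hde : d ≠ e) (h1 : G.degree b = G.degree a)
    (h2 : G.degree c = G.degree b + 1) (h3 : G.degree d = G.degree c + 1)
    (h4 : G.degree e = G.degree d) : False := by
  have t1 := hG.zero_one_one hab hac had hbc hbd hcd h1 h2 h3
  have t2 := hG.zero_one_one hab hac hae hbc hbe hce h1 h2 (by omega)
  have t3 := hG.nearTwin_one_zero hcd hce hde h3 h4
  simp only [NearTwin] at t3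
  grind [G.adj_comm]

/-- The lower four make `c, d` adjacent and let them differ on `a`; each alternative for `c, d, e`
contradicts one of these facts. -/
theorem not_zero_one_one_one (hG : G.RepFree) {a b c d e : V} (hab : a ≠ b) (hac : a ≠ c)
    (had : a ≠ d) (hae : a ≠ e) (hbc : b ≠ c) (hbd : b ≠ d) (hbe : b ≠ e) (hcd : c ≠ d)
    (hce : c ≠ e) (hde : d ≠ e) (h1 : G.degree b = G.degree a)
    (h2 : G.degree c = G.degree b + 1) (h3 : G.degree d = G.degree c + 1)
    (h4 : G.degree e = G.degree d + 1) : False := by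
  have t1 := hG.zero_one_one hab hac had hbc hbd hcd h1 h2 h3
  have t2 := hG.nearTwin_zero_one hab hac hbc h1.symm h2
  have t3 := hG.nearTwin_one_one hcd hce hde h3 h4
  simp only [NearTwin, NearTwinTwo] at t2 t3
  grind [G.adj_comm]

/-- Degrees `d, d, d + 1, d + 1, d + 3`. -/
theorem not_zero_one_zero_two (hG : G.RepFree) {a b c d e : V} (hab : a ≠ b) (hac : a ≠ c)
    (had : a ≠ d) (hae : a ≠ e) (hbc : b ≠ c) (hbd : b ≠ d) (hbe : b ≠ e) (hcd : c ≠ d)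
    (hce : c ≠ e) (hde : d ≠ e) (h1 : G.degree b = G.degree a)
    (h2 : G.degree c = G.degree b + 1) (h3 : G.degree d = G.degree c)
    (h4 : G.degree e = G.degree d + 2) : False := by
  wlog hP : G.Adj a d generalizing a b
  · obtain ⟨u1, u2, u3⟩ := hG.zero_one_zero hab hac had hbc hbd hcd h1 h2 h3
    exact this hab.symm hbc hbd hbe hac had hae (by omega) (by omega) (by grind)
  obtain ⟨u1, u2, u3⟩ := hG.zero_one_zero hab hac had hbc hbd hcd h1 h2 h3
  have u3' : G.Adj a d ∧ G.Adj b c ∧ ¬ G.Adj a c ∧ ¬ G.Adj b d ∧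
      ∀ w, w ≠ a → w ≠ b → w ≠ c → w ≠ d → (G.Adj w a ↔ G.Adj w c) ∧ (G.Adj w b ↔ G.Adj w c) ∧
      (G.Adj w d ↔ G.Adj w c) := by grind
  obtain ⟨v1, v2, v3, v4, v5⟩ := u3'
  -- Seen from outside the four vertices are alike, so `e` is adjacent to all of them or to none.
  obtain ⟨w1, w2, w3⟩ := v5 e hae.symm hbe.symm hce.symm hde.symm
  have out := degree_add_outDiff_triple (G := G) hcd hce hde c e
  have s1 := adjNat_self (G := G) c
  have s2 := adjNat_self (G := G) e
  have c1 := adjNat_comm (G := G) e c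
  have c2 := adjNat_comm (G := G) e d
  have c3 := adjNat_of_adj u2
  have mem : ∀ x, x ∈ (({c, d, e} : Finset V)ᶜ.filter fun w => G.Adj e w ∧ ¬ G.Adj c w) →
      x ≠ c ∧ x ≠ d ∧ x ≠ e ∧ G.Adj e x ∧ ¬ G.Adj c x := by
    intro x hx
    simp only [Finset.mem_filter, Finset.mem_compl, Finset.mem_insert, Finset.mem_singleton,
      not_or] at hx
    obtain ⟨⟨h1, h2, h3⟩, h4, h5⟩ := hx
    exact ⟨h1, h2, h3, h4, h5⟩
  have far : ∀ x, x ≠ a → x ≠ b → x ≠ c → x ≠ d → ¬ G.Adj c x → ¬ G.Adj d x :=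
    fun x xa xb xc xd xnc h => xnc ((v5 x xa xb xc xd).2.2.1 h.symm).symm
  by_cases hce' : G.Adj e c
  · have hde' := w3.2 hce'
    have c4 := adjNat_of_adj hce'
    have c5 := adjNat_of_adj hde'
    have h2 : 2 ≤ G.outDiff {c, d, e} e c := by omega
    -- One private neighbour of `e` against `c` may be `a`, hence the choice of another. Deleting
    -- `a, b, x` costs `c, d, e` the amounts 1, 1, 3.
    obtain ⟨x, hx, xa⟩ := Finset.exists_mem_ne h2 a
    obtain ⟨x1, x2, x3, x4, x5⟩ := mem x hx
    have xb : x ≠ b := by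
      rintro rfl
      exact x5 v2.symm
    have x6 := far x xa xb x1 x2 x5
    have hea := w1.2 hce'
    have heb := w2.2 hce'
    have hda := v1.symm
    have hcb := v2.symm
    have hca : ¬ G.Adj c a := fun h => v3 h.symm
    have hdb : ¬ G.Adj d b := fun h => v4 h.symm
    refine hG.not_three hcd hce hde hac had hae hbc hbd hbe x1 x2 x3 hab xa.symm xb.symm ?_ ?_ <;>
      simp only [adjNat, x4, x5, x6, hea, heb, hda, hcb, hca, hdb, if_true, if_false] <;> omega
  · have hde' := fun h => hce' (w3.1 h)
    have c4 := adjNat_of_not_adj hce'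
    have c5 := adjNat_of_not_adj hde'
    have h2 : 2 ≤ G.outDiff {c, d, e} e c := by omega
    obtain ⟨x, hx, y, hy, hxy⟩ := Finset.one_lt_card.1 h2
    obtain ⟨x1, x2, x3, x4, x5⟩ := mem x hx
    obtain ⟨y1, y2, y3, y4, y5⟩ := mem y hy
    have x6 := far x (fun h => hce' (w1.1 (h ▸ x4))) (fun h => hce' (w2.1 (h ▸ x4))) x1 x2 x5
    have y6 := far y (fun h => hce' (w1.1 (h ▸ y4))) (fun h => hce' (w2.1 (h ▸ y4))) y1 y2 y5
    -- Both `x` and `y` are seen by `e` only, which removes its excess of two.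
    refine hG.not_two hcd hce hde x1 x2 x3 y1 y2 y3 hxy ?_ ?_ <;>
      simp only [adjNat, x4, x5, x6, y4, y5, y6, if_true, if_false] <;> omega

end RepFree

/-! ### Bounds on adjacency classes of a triple -/

variable (G)

/-- Whether `w` is adjacent to `a`, `b` and `c` in the prescribed way. -/
def hasPattern (a b c : V) (pa pb pc : Bool) (w : V) : Bool :=
  decide (G.Adj a w) == pa && decide (G.Adj b w) == pb && decide (G.Adj c w) == pc

/-- The vertices other than `a, b, c` that are adjacent to `a`, `b` and `c` in the prescribed
way. -/
def patternClass (a b c : V) (pa pb pc : Bool) : Finset V :=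
  Finset.univ.filter fun w => w ≠ a ∧ w ≠ b ∧ w ≠ c ∧ G.hasPattern a b c pa pb pc w = true

variable {G}

theorem mem_patternClass {a b c : V} {pa pb pc : Bool} {w : V} :
    w ∈ G.patternClass a b c pa pb pc ↔ w ≠ a ∧ w ≠ b ∧ w ≠ c ∧
      decide (G.Adj a w) = pa ∧ decide (G.Adj b w) = pb ∧ decide (G.Adj c w) = pc := by
  simp [patternClass, hasPattern, and_assoc]

namespace RepFree

/-- Each bound on classes forbids a deletion whose costs make up for the gaps; here three vertices
seen by `c` only would cost 0, 0, 3. -/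
theorem card_patternClass_zero_three (hG : G.RepFree) {a b c : V} (hab : a ≠ b) (hac : a ≠ c)
    (hbc : b ≠ c) (h1 : G.degree b = G.degree a) (h2 : G.degree c = G.degree b + 3) :
    (G.patternClass a b c false false true).card ≤ 2 := by
  by_contra! h
  obtain ⟨x, hx, y, hy, z, hz, hxy, hxz, hyz⟩ := Finset.two_lt_card.1 h
  simp only [mem_patternClass, decide_eq_true_eq, decide_eq_false_iff_not] at hx hy hz
  obtain ⟨x1, x2, x3, x4, x5, x6⟩ := hx
  obtain ⟨y1, y2, y3, y4, y5, y6⟩ := hy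
  obtain ⟨z1, z2, z3, z4, z5, z6⟩ := hz
  refine hG.not_three hab hac hbc x1 x2 x3 y1 y2 y3 z1 z2 z3 hxy hxz hyz ?_ ?_ <;>
    simp only [adjNat, x4, x5, x6, y4, y5, y6, z4, z5, z6, if_true, if_false] <;> omega

theorem card_patternClass_three_zero (hG : G.RepFree) {a b c : V} (hab : a ≠ b) (hac : a ≠ c)
    (hbc : b ≠ c) (h1 : G.degree b = G.degree a + 3) (h2 : G.degree c = G.degree b) :
    (G.patternClass a b c false true true).card ≤ 2 := by
  by_contra! h
  obtain ⟨x, hx, y, hy, z, hz, hxy, hxz, hyz⟩ := Finset.two_lt_card.1 h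
  simp only [mem_patternClass, decide_eq_true_eq, decide_eq_false_iff_not] at hx hy hz
  obtain ⟨x1, x2, x3, x4, x5, x6⟩ := hx
  obtain ⟨y1, y2, y3, y4, y5, y6⟩ := hy
  obtain ⟨z1, z2, z3, z4, z5, z6⟩ := hz
  refine hG.not_three hab hac hbc x1 x2 x3 y1 y2 y3 z1 z2 z3 hxy hxz hyz ?_ ?_ <;>
    simp only [adjNat, x4, x5, x6, y4, y5, y6, z4, z5, z6, if_true, if_false] <;> omega

/-- Two vertices of the first class and one of the second would cost 0, 1, 3. -/
theorem card_patternClass_one_two (hG : G.RepFree) {a b c : V} (hab : a ≠ b) (hac : a ≠ c)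
    (hbc : b ≠ c) (h1 : G.degree b = G.degree a + 1) (h2 : G.degree c = G.degree b + 2) :
    (G.patternClass a b c false false true).card ≤ 1 ∨
      (G.patternClass a b c false true true).card ≤ 0 := by
  by_contra! h
  obtain ⟨x, hx, y, hy, hxy⟩ := Finset.one_lt_card.1 h.1
  obtain ⟨z, hz⟩ := Finset.card_pos.1 h.2
  simp only [mem_patternClass, decide_eq_true_eq, decide_eq_false_iff_not] at hx hy hz
  obtain ⟨x1, x2, x3, x4, x5, x6⟩ := hx
  obtain ⟨y1, y2, y3, y4, y5, y6⟩ := hy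
  obtain ⟨z1, z2, z3, z4, z5, z6⟩ := hz
  refine hG.not_three hab hac hbc x1 x2 x3 y1 y2 y3 z1 z2 z3 hxy
    (fun h => x5 (h ▸ z5)) (fun h => y5 (h ▸ z5)) ?_ ?_ <;>
    simp only [adjNat, x4, x5, x6, y4, y5, y6, z4, z5, z6, if_true, if_false] <;> omega

/-- Two vertices seen by `b, c` only, or one from each of the three classes, would cost 0, 2, 2. -/
theorem card_patternClass_two_zero (hG : G.RepFree) {a b c : V} (hab : a ≠ b) (hac : a ≠ c)
    (hbc : b ≠ c) (h1 : G.degree b = G.degree a + 2) (h2 : G.degree c = G.degree b) :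
    (G.patternClass a b c false true true).card ≤ 1 ∧
      ((G.patternClass a b c false false true).card ≤ 0 ∨
        (G.patternClass a b c false true true).card ≤ 0 ∨
        (G.patternClass a b c false true false).card ≤ 0) := by
  constructor
  · by_contra! h
    obtain ⟨x, hx, y, hy, hxy⟩ := Finset.one_lt_card.1 h
    simp only [mem_patternClass, decide_eq_true_eq, decide_eq_false_iff_not] at hx hy
    obtain ⟨x1, x2, x3, x4, x5, x6⟩ := hx
    obtain ⟨y1, y2, y3, y4, y5, y6⟩ := hy
    refine hG.not_two hab hac hbc x1 x2 x3 y1 y2 y3 hxy ?_ ?_ <;>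
      simp only [adjNat, x4, x5, x6, y4, y5, y6, if_true, if_false] <;> omega
  · by_contra! h
    obtain ⟨x, hx⟩ := Finset.card_pos.1 h.1
    obtain ⟨y, hy⟩ := Finset.card_pos.1 h.2.1
    obtain ⟨z, hz⟩ := Finset.card_pos.1 h.2.2
    simp only [mem_patternClass, decide_eq_true_eq, decide_eq_false_iff_not] at hx hy hz
    obtain ⟨x1, x2, x3, x4, x5, x6⟩ := hx
    obtain ⟨y1, y2, y3, y4, y5, y6⟩ := hy
    obtain ⟨z1, z2, z3, z4, z5, z6⟩ := hz
    refine hG.not_three hab hac hbc x1 x2 x3 y1 y2 y3 z1 z2 z3 (fun h => x5 (h ▸ y5))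
      (fun h => x5 (h ▸ z5)) (fun h => z6 (h ▸ y6)) ?_ ?_ <;>
      simp only [adjNat, x4, x5, x6, y4, y5, y6, z4, z5, z6, if_true, if_false] <;> omega

/-- Two vertices seen by `c` only would cost 0, 0, 2; one from each of the three classes would cost
1, 1, 3. -/
theorem card_patternClass_zero_two (hG : G.RepFree) {a b c : V} (hab : a ≠ b) (hac : a ≠ c)
    (hbc : b ≠ c) (h1 : G.degree b = G.degree a) (h2 : G.degree c = G.degree b + 2) :
    (G.patternClass a b c false false true).card ≤ 1 ∧
      ((G.patternClass a b c false false true).card ≤ 0 ∨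
        (G.patternClass a b c false true true).card ≤ 0 ∨
        (G.patternClass a b c true false true).card ≤ 0) := by
  constructor
  · by_contra! h
    obtain ⟨x, hx, y, hy, hxy⟩ := Finset.one_lt_card.1 h
    simp only [mem_patternClass, decide_eq_true_eq, decide_eq_false_iff_not] at hx hy
    obtain ⟨x1, x2, x3, x4, x5, x6⟩ := hx
    obtain ⟨y1, y2, y3, y4, y5, y6⟩ := hy
    refine hG.not_two hab hac hbc x1 x2 x3 y1 y2 y3 hxy ?_ ?_ <;>
      simp only [adjNat, x4, x5, x6, y4, y5, y6, if_true, if_false] <;> omega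
  · by_contra! h
    obtain ⟨x, hx⟩ := Finset.card_pos.1 h.1
    obtain ⟨y, hy⟩ := Finset.card_pos.1 h.2.1
    obtain ⟨z, hz⟩ := Finset.card_pos.1 h.2.2
    simp only [mem_patternClass, decide_eq_true_eq, decide_eq_false_iff_not] at hx hy hz
    obtain ⟨x1, x2, x3, x4, x5, x6⟩ := hx
    obtain ⟨y1, y2, y3, y4, y5, y6⟩ := hy
    obtain ⟨z1, z2, z3, z4, z5, z6⟩ := hz
    refine hG.not_three hab hac hbc x1 x2 x3 y1 y2 y3 z1 z2 z3 (fun h => x5 (h ▸ y5))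
      (fun h => x4 (h ▸ z4)) (fun h => y4 (h ▸ z4)) ?_ ?_ <;>
      simp only [adjNat, x4, x5, x6, y4, y5, y6, z4, z5, z6, if_true, if_false] <;> omega

end RepFree

/-! ### Linear systems for the gaps 0, 1, 2, 0 and 1, 0, 2, 0 -/

variable (G) in
/-- The adjacencies of `w` to `z, s, u, v`. -/
def signature (z s u v w : V) : Bool × Bool × Bool × Bool :=
  (decide (G.Adj z w), decide (G.Adj s w), decide (G.Adj u w), decide (G.Adj v w))

/-- Splits a count by type. As `Q` is Boolean, the sum later evaluates to an explicit sum of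
unknowns. -/
theorem card_filter_comp {α β : Type*} [Fintype β] [DecidableEq β] (O : Finset α) (f : α → β)
    (P : α → Prop) [DecidablePred P] (Q : β → Bool) (h : ∀ w ∈ O, P w ↔ Q (f w) = true) :
    (O.filter P).card = ∑ k, bif Q k then (O.filter fun w => f w = k).card else 0 := by
  rw [Finset.card_eq_sum_card_fiberwise (f := f) (t := Finset.univ) (by simp)]
  refine Finset.sum_congr rfl fun k _ => ?_
  rw [Finset.filter_filter]
  cases hk : Q k
  · simp only [cond_false, Finset.card_eq_zero, Finset.filter_eq_empty_iff]
    rintro w hw ⟨h1, rfl⟩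
    rw [h w hw, hk] at h1
    exact Bool.false_ne_true h1
  · simp only [cond_true]
    congr 1
    refine Finset.filter_congr fun w hw => ?_
    constructor
    · exact fun h => h.2
    · rintro rfl
      exact ⟨(h w hw).2 hk, rfl⟩

/-- A class of the triple `a, b, c` may also contain the other two named vertices, so these are
counted besides `O`. -/
theorem toNat_add_le_card_patternClass {a b c d e : V} (O : Finset V)
    (hO : ∀ w ∈ O, w ≠ a ∧ w ≠ b ∧ w ≠ c ∧ w ≠ d ∧ w ≠ e)
    (hda : d ≠ a) (hdb : d ≠ b) (hdc : d ≠ c) (hea : e ≠ a) (heb : e ≠ b) (hec : e ≠ c)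
    (hde : d ≠ e) (pa pb pc : Bool) :
    (O.filter fun w => G.hasPattern a b c pa pb pc w = true).card +
      (G.hasPattern a b c pa pb pc d).toNat + (G.hasPattern a b c pa pb pc e).toNat ≤
      (G.patternClass a b c pa pb pc).card := by
  have h1 : ∀ x, (({x} : Finset V).filter fun w => G.hasPattern a b c pa pb pc w = true).card =
      (G.hasPattern a b c pa pb pc x).toNat := by
    intro x
    rw [Finset.filter_singleton]
    cases G.hasPattern a b c pa pb pc x <;> simp
  rw [← h1, ← h1, ← Finset.card_union_of_disjoint, ← Finset.card_union_of_disjoint]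
  · refine Finset.card_le_card fun w hw => ?_
    simp only [patternClass, Finset.mem_filter, Finset.mem_univ, true_and]
    simp only [Finset.mem_union, Finset.mem_filter, Finset.mem_singleton] at hw
    rcases hw with (⟨hw, hp⟩ | ⟨rfl, hp⟩) | ⟨rfl, hp⟩
    · obtain ⟨x1, x2, x3, -⟩ := hO w hw
      exact ⟨x1, x2, x3, hp⟩
    · exact ⟨hda, hdb, hdc, hp⟩
    · exact ⟨hea, heb, hec, hp⟩
  · rw [Finset.disjoint_left]
    intro w hw hw'
    simp only [Finset.mem_union, Finset.mem_filter, Finset.mem_singleton] at hw hw'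
    rcases hw with ⟨hw, hp⟩ | ⟨rfl, hp⟩
    · exact (hO w hw).2.2.2.2 hw'.1
    · exact hde hw'.1
  · rw [Finset.disjoint_left]
    intro w hw hw'
    simp only [Finset.mem_filter, Finset.mem_singleton] at hw hw'
    exact (hO w hw.1).2.2.2.1 hw'.1

theorem degree_eq_add_card_filter {a b c d e : V} (hab : a ≠ b) (hac : a ≠ c) (had : a ≠ d)
    (hae : a ≠ e) (hbc : b ≠ c) (hbd : b ≠ d) (hbe : b ≠ e) (hcd : c ≠ d) (hce : c ≠ e)
    (hde : d ≠ e) (x : V) :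
    G.degree x = (({a, b, c, d, e} : Finset V)ᶜ.filter (G.Adj x)).card + (G.adjNat x a +
      G.adjNat x b + G.adjNat x c + G.adjNat x d + G.adjNat x e) := by
  have h1 : G.degree x = (Finset.univ.filter (G.Adj x)).card := by
    rw [← G.card_neighborFinset_eq_degree, G.neighborFinset_eq_filter]
  have h2 : (({a, b, c, d, e} : Finset V).filter (G.Adj x)).card = G.adjNat x a +
      G.adjNat x b + G.adjNat x c + G.adjNat x d + G.adjNat x e := by
    rw [card_filter_insert (by simp [hab, hac, had, hae]),
      card_filter_insert (by simp [hbc, hbd, hbe]), card_filter_insert (by simp [hcd, hce]),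
      card_filter_insert (by simp [hde]), ← insert_empty_eq e, card_filter_insert (by simp)]
    simp [add_assoc]
  have h3 : Disjoint (({a, b, c, d, e} : Finset V)ᶜ.filter (G.Adj x))
      (({a, b, c, d, e} : Finset V).filter (G.Adj x)) :=
    Finset.disjoint_filter_filter disjoint_compl_left
  have h4 : (Finset.univ.filter (G.Adj x)) = ({a, b, c, d, e} : Finset V)ᶜ.filter (G.Adj x) ∪
      ({a, b, c, d, e} : Finset V).filter (G.Adj x) := by
    rw [← Finset.filter_union, Finset.union_comm, Finset.union_compl]
  rw [h1, h4, Finset.card_union_of_disjoint h3, h2]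

theorem sum_add_le_card_patternClass {z s u v a b c d e : V} (O : Finset V)
    (hO : ∀ w ∈ O, w ≠ a ∧ w ≠ b ∧ w ≠ c ∧ w ≠ d ∧ w ≠ e)
    (hda : d ≠ a) (hdb : d ≠ b) (hdc : d ≠ c) (hea : e ≠ a) (heb : e ≠ b) (hec : e ≠ c)
    (hde : d ≠ e) (pa pb pc : Bool) (Q : Bool × Bool × Bool × Bool → Bool)
    (hQ : ∀ w ∈ O, G.hasPattern a b c pa pb pc w = Q (G.signature z s u v w)) :
    (∑ k, bif Q k then (O.filter fun w => G.signature z s u v w = k).card else 0) +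
      (G.hasPattern a b c pa pb pc d).toNat + (G.hasPattern a b c pa pb pc e).toNat ≤
      (G.patternClass a b c pa pb pc).card := by
  rw [← card_filter_comp O (G.signature z s u v)
    (fun w => G.hasPattern a b c pa pb pc w = true) Q fun w hw => by rw [hQ w hw]]
  exact toNat_add_le_card_patternClass O hO hda hdb hdc hea heb hec hde pa pb pc

theorem beq_true_eq (b : Bool) : (b == true) = b := by cases b <;> rfl

theorem beq_false_eq (b : Bool) : (b == false) = !b := by cases b <;> rfl

theorem adjNat_eq_toNat (u v : V) : G.adjNat u v = (decide (G.Adj u v)).toNat := by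
  by_cases h : G.Adj u v <;> simp [adjNat, h]

set_option maxHeartbeats 4000000 in
-- Outside the five vertices `t` sees what `s` sees, so sixteen types of outside vertices suffice.
-- The degree equations and the class bounds of every triple except `z, s, t` form a system in the
-- sixteen counts, infeasible for each choice of the undetermined edges.
theorem RepFree.not_twin_window_zero (hG : G.RepFree) {z s t u v : V} (hzs : z ≠ s) (hzt : z ≠ t)
    (hzu : z ≠ u) (hzv : z ≠ v) (hst : s ≠ t) (hsu : s ≠ u) (hsv : s ≠ v) (htu : t ≠ u)
    (htv : t ≠ v) (huv : u ≠ v) (hN : G.NearTwin s t z) (dt : G.degree t = G.degree s + 1)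
    (dz : G.degree z = G.degree s) (du : G.degree u = G.degree s + 3)
    (dv : G.degree v = G.degree s + 3) : False := by
  obtain ⟨hzt', hzs', hst'⟩ := hN
  obtain ⟨O, hO⟩ : ∃ O, O = ({z, s, t, u, v} : Finset V)ᶜ := ⟨_, rfl⟩
  have hmem : ∀ w ∈ O, w ≠ z ∧ w ≠ s ∧ w ≠ t ∧ w ≠ u ∧ w ≠ v := by
    intro w hw
    rw [hO] at hw
    simpa only [Finset.mem_compl, Finset.mem_insert, Finset.mem_singleton, not_or] using hw
  have ht : ∀ w ∈ O, decide (G.Adj t w) = decide (G.Adj s w) := by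
    intro w hw
    obtain ⟨w1, w2, w3, -, -⟩ := hmem w hw
    have := hst' w w2 w3 w1
    simp only [G.adj_comm w] at this
    simp only [this]
  have deg_z := degree_eq_add_card_filter (G := G) hzs hzt hzu hzv hst hsu hsv htu htv huv z
  rw [← hO, card_filter_comp O (G.signature z s u v) (G.Adj z) (fun k => k.1)
    (by simp [signature])] at deg_z
  have deg_s := degree_eq_add_card_filter (G := G) hzs hzt hzu hzv hst hsu hsv htu htv huv s
  rw [← hO, card_filter_comp O (G.signature z s u v) (G.Adj s) (fun k => k.2.1)
    (by simp [signature])] at deg_s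
  have deg_u := degree_eq_add_card_filter (G := G) hzs hzt hzu hzv hst hsu hsv htu htv huv u
  rw [← hO, card_filter_comp O (G.signature z s u v) (G.Adj u) (fun k => k.2.2.1)
    (by simp [signature])] at deg_u
  have deg_v := degree_eq_add_card_filter (G := G) hzs hzt hzu hzv hst hsu hsv htu htv huv v
  rw [← hO, card_filter_comp O (G.signature z s u v) (G.Adj v) (fun k => k.2.2.2)
    (by simp [signature])] at deg_v
  have c_szu := hG.card_patternClass_zero_three hzs.symm hsu hzu (by omega) (by omega)
  have szu_A := sum_add_le_card_patternClass (G := G) (z := z) (s := s) (u := u) (v := v)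
    (a := s) (b := z) (c := u) (d := t) (e := v) O (by grind) hst.symm hzt.symm htu
    hsv.symm hzv.symm huv.symm htv false false true
      (fun k => k.2.1 == false && k.1 == false && k.2.2.1 == true)
    (by intro w hw; simp only [hasPattern, signature])
  have c_szv := hG.card_patternClass_zero_three hzs.symm hsv hzv (by omega) (by omega)
  have szv_A := sum_add_le_card_patternClass (G := G) (z := z) (s := s) (u := u) (v := v)
    (a := s) (b := z) (c := v) (d := t) (e := u) O (by grind) hst.symm hzt.symm htv
    hsu.symm hzu.symm huv htu false false true
      (fun k => k.2.1 == false && k.1 == false && k.2.2.2 == true)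
    (by intro w hw; simp only [hasPattern, signature])
  have c_stu := hG.card_patternClass_one_two hst hsu htu (by omega) (by omega)
  have stu_A := sum_add_le_card_patternClass (G := G) (z := z) (s := s) (u := u) (v := v)
    (a := s) (b := t) (c := u) (d := z) (e := v) O (by grind) hzs hzt hzu
    hsv.symm htv.symm huv.symm hzv false false true
      (fun k => k.2.1 == false && k.2.1 == false && k.2.2.1 == true)
    (by intro w hw; simp only [hasPattern, signature, ht w hw])
  have stu_B := sum_add_le_card_patternClass (G := G) (z := z) (s := s) (u := u) (v := v)
    (a := s) (b := t) (c := u) (d := z) (e := v) O (by grind) hzs hzt hzu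
    hsv.symm htv.symm huv.symm hzv false true true
      (fun k => k.2.1 == false && k.2.1 == true && k.2.2.1 == true)
    (by intro w hw; simp only [hasPattern, signature, ht w hw])
  have c_stv := hG.card_patternClass_one_two hst hsv htv (by omega) (by omega)
  have stv_A := sum_add_le_card_patternClass (G := G) (z := z) (s := s) (u := u) (v := v)
    (a := s) (b := t) (c := v) (d := z) (e := u) O (by grind) hzs hzt hzv
    hsu.symm htu.symm huv hzu false false true
      (fun k => k.2.1 == false && k.2.1 == false && k.2.2.2 == true)
    (by intro w hw; simp only [hasPattern, signature, ht w hw])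
  have stv_B := sum_add_le_card_patternClass (G := G) (z := z) (s := s) (u := u) (v := v)
    (a := s) (b := t) (c := v) (d := z) (e := u) O (by grind) hzs hzt hzv
    hsu.symm htu.symm huv hzu false true true
      (fun k => k.2.1 == false && k.2.1 == true && k.2.2.2 == true)
    (by intro w hw; simp only [hasPattern, signature, ht w hw])
  have c_suv := hG.card_patternClass_three_zero hsu hsv huv (by omega) (by omega)
  have suv_B := sum_add_le_card_patternClass (G := G) (z := z) (s := s) (u := u) (v := v)
    (a := s) (b := u) (c := v) (d := z) (e := t) O (by grind) hzs hzu hzv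
    hst.symm htu htv hzt false true true (fun k => k.2.1 == false && k.2.2.1 == true && k.2.2.2 ==
      true)
    (by intro w hw; simp only [hasPattern, signature])
  have c_ztu := hG.card_patternClass_one_two hzt hzu htu (by omega) (by omega)
  have ztu_A := sum_add_le_card_patternClass (G := G) (z := z) (s := s) (u := u) (v := v)
    (a := z) (b := t) (c := u) (d := s) (e := v) O (by grind) hzs.symm hst hsu
    hzv.symm htv.symm huv.symm hsv false false true
      (fun k => k.1 == false && k.2.1 == false && k.2.2.1 == true)
    (by intro w hw; simp only [hasPattern, signature, ht w hw])
  have ztu_B := sum_add_le_card_patternClass (G := G) (z := z) (s := s) (u := u) (v := v)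
    (a := z) (b := t) (c := u) (d := s) (e := v) O (by grind) hzs.symm hst hsu
    hzv.symm htv.symm huv.symm hsv false true true
      (fun k => k.1 == false && k.2.1 == true && k.2.2.1 == true)
    (by intro w hw; simp only [hasPattern, signature, ht w hw])
  have c_ztv := hG.card_patternClass_one_two hzt hzv htv (by omega) (by omega)
  have ztv_A := sum_add_le_card_patternClass (G := G) (z := z) (s := s) (u := u) (v := v)
    (a := z) (b := t) (c := v) (d := s) (e := u) O (by grind) hzs.symm hst hsv
    hzu.symm htu.symm huv hsu false false true
      (fun k => k.1 == false && k.2.1 == false && k.2.2.2 == true)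
    (by intro w hw; simp only [hasPattern, signature, ht w hw])
  have ztv_B := sum_add_le_card_patternClass (G := G) (z := z) (s := s) (u := u) (v := v)
    (a := z) (b := t) (c := v) (d := s) (e := u) O (by grind) hzs.symm hst hsv
    hzu.symm htu.symm huv hsu false true true
      (fun k => k.1 == false && k.2.1 == true && k.2.2.2 == true)
    (by intro w hw; simp only [hasPattern, signature, ht w hw])
  have c_zuv := hG.card_patternClass_three_zero hzu hzv huv (by omega) (by omega)
  have zuv_B := sum_add_le_card_patternClass (G := G) (z := z) (s := s) (u := u) (v := v)
    (a := z) (b := u) (c := v) (d := s) (e := t) O (by grind) hzs.symm hsu hsv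
    hzt.symm htu htv hst false true true (fun k => k.1 == false && k.2.2.1 == true && k.2.2.2 ==
      true)
    (by intro w hw; simp only [hasPattern, signature])
  have c_tuv := hG.card_patternClass_two_zero htu htv huv (by omega) (by omega)
  have tuv_A := sum_add_le_card_patternClass (G := G) (z := z) (s := s) (u := u) (v := v)
    (a := t) (b := u) (c := v) (d := z) (e := s) O (by grind) hzt hzu hzv
    hst hsu hsv hzs false false true (fun k => k.2.1 == false && k.2.2.1 == false && k.2.2.2 ==
      true)
    (by intro w hw; simp only [hasPattern, signature, ht w hw])
  have tuv_B := sum_add_le_card_patternClass (G := G) (z := z) (s := s) (u := u) (v := v)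
    (a := t) (b := u) (c := v) (d := z) (e := s) O (by grind) hzt hzu hzv
    hst hsu hsv hzs false true true (fun k => k.2.1 == false && k.2.2.1 == true && k.2.2.2 == true)
    (by intro w hw; simp only [hasPattern, signature, ht w hw])
  have tuv_C := sum_add_le_card_patternClass (G := G) (z := z) (s := s) (u := u) (v := v)
    (a := t) (b := u) (c := v) (d := z) (e := s) O (by grind) hzt hzu hzv
    hst hsu hsv hzs false true false (fun k => k.2.1 == false && k.2.2.1 == true && k.2.2.2 ==
      false)
    (by intro w hw; simp only [hasPattern, signature, ht w hw])
  -- From here on the sixteen counts are opaque unknowns.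
  generalize hT : (fun k => (O.filter fun w => G.signature z s u v w = k).card) = T
  have hT' : ∀ k, (O.filter fun w => G.signature z s u v w = k).card = T k := fun k => by rw [← hT]
  have hu := hst' u hsu.symm htu.symm hzu.symm
  have hv := hst' v hsv.symm htv.symm hzv.symm
  -- Six edges remain free: the near-twin relation fixes `z` against `s, t` and copies the edges
  -- from `s` to `u, v` onto `t`.
  obtain ⟨bzu, h_zu⟩ : ∃ b, b = decide (G.Adj z u) := ⟨_, rfl⟩
  obtain ⟨bzv, h_zv⟩ : ∃ b, b = decide (G.Adj z v) := ⟨_, rfl⟩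
  obtain ⟨bst, h_st⟩ : ∃ b, b = decide (G.Adj s t) := ⟨_, rfl⟩
  obtain ⟨bsu, h_su⟩ : ∃ b, b = decide (G.Adj s u) := ⟨_, rfl⟩
  obtain ⟨bsv, h_sv⟩ : ∃ b, b = decide (G.Adj s v) := ⟨_, rfl⟩
  obtain ⟨buv, h_uv⟩ : ∃ b, b = decide (G.Adj u v) := ⟨_, rfl⟩
  have e_zz : decide (G.Adj z z) = false := by simp
  have e_zs : decide (G.Adj z s) = false := by simp [hzs']
  have e_zt : decide (G.Adj z t) = true := by simp [hzt']
  have e_zu : decide (G.Adj z u) = bzu := by grind [G.adj_comm]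
  have e_zv : decide (G.Adj z v) = bzv := by grind [G.adj_comm]
  have e_sz : decide (G.Adj s z) = false := by simp [hzs', G.adj_comm]
  have e_ss : decide (G.Adj s s) = false := by simp
  have e_st : decide (G.Adj s t) = bst := by grind [G.adj_comm]
  have e_su : decide (G.Adj s u) = bsu := by grind [G.adj_comm]
  have e_sv : decide (G.Adj s v) = bsv := by grind [G.adj_comm]
  have e_tz : decide (G.Adj t z) = true := by simp [hzt', G.adj_comm]
  have e_ts : decide (G.Adj t s) = bst := by grind [G.adj_comm]
  have e_tt : decide (G.Adj t t) = false := by simp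
  have e_tu : decide (G.Adj t u) = bsu := by grind [G.adj_comm]
  have e_tv : decide (G.Adj t v) = bsv := by grind [G.adj_comm]
  have e_uz : decide (G.Adj u z) = bzu := by grind [G.adj_comm]
  have e_us : decide (G.Adj u s) = bsu := by grind [G.adj_comm]
  have e_ut : decide (G.Adj u t) = bsu := by grind [G.adj_comm]
  have e_uu : decide (G.Adj u u) = false := by simp
  have e_uv : decide (G.Adj u v) = buv := by grind [G.adj_comm]
  have e_vz : decide (G.Adj v z) = bzv := by grind [G.adj_comm]
  have e_vs : decide (G.Adj v s) = bsv := by grind [G.adj_comm]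
  have e_vt : decide (G.Adj v t) = bsv := by grind [G.adj_comm]
  have e_vu : decide (G.Adj v u) = buv := by grind [G.adj_comm]
  have e_vv : decide (G.Adj v v) = false := by simp
  simp only [hasPattern, adjNat_eq_toNat, e_zz, e_zs, e_zt, e_zu, e_zv, e_sz, e_ss, e_st, e_su,
    e_sv, e_tz, e_ts, e_tu, e_tv, e_uz, e_us, e_ut, e_uu, e_uv, e_vz, e_vs, e_vt, e_vu, e_vv, hT',
    Fintype.sum_prod_type, Fintype.sum_bool]
    at deg_z deg_s deg_u deg_v szu_A szv_A stu_A stu_B stv_A stv_B suv_B ztu_A ztu_B ztv_A ztv_B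
      zuv_B tuv_A tuv_B tuv_C
  clear h_zu h_zv h_st h_su h_sv h_uv e_zz e_zs e_zt e_zu e_zv e_sz e_ss e_st e_su e_sv e_tz e_ts
    e_tt e_tu e_tv e_uz e_us e_ut e_uu e_uv e_vz e_vs e_vt e_vu e_vv
  rw [du, deg_s] at deg_u
  rw [dv, deg_s] at deg_v
  rw [dz, deg_s] at deg_z
  replace c_szu := szu_A.trans c_szu
  replace c_szv := szv_A.trans c_szv
  replace c_stu := c_stu.imp stu_A.trans stu_B.trans
  replace c_stv := c_stv.imp stv_A.trans stv_B.trans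
  replace c_suv := suv_B.trans c_suv
  replace c_ztu := c_ztu.imp ztu_A.trans ztu_B.trans
  replace c_ztv := c_ztv.imp ztv_A.trans ztv_B.trans
  replace c_zuv := zuv_B.trans c_zuv
  replace c_tuv := c_tuv.imp tuv_B.trans
    (Or.imp tuv_A.trans (Or.imp tuv_B.trans tuv_C.trans))
  clear deg_s szu_A szv_A stu_A stu_B stv_A stv_B suv_B ztu_A ztu_B ztv_A ztv_B zuv_B tuv_A tuv_B
    tuv_C
  clear hT hT' ht hmem hO hst' hG dt dz du dv hu hv hzt' hzs'
  simp only [cond_true, cond_false, Bool.and_true, Bool.and_false, Bool.true_and, Bool.false_and,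
    beq_true_eq, beq_false_eq, Bool.not_true, Bool.not_false,
    Bool.toNat_true, Bool.toNat_false, Nat.add_zero, Nat.zero_add]
    at deg_z deg_u deg_v c_szu c_szv c_stu c_stv c_suv c_ztu c_ztv c_zuv c_tuv
  cases bzu <;> cases bzv <;> cases bst <;> cases bsu <;> cases bsv <;> cases buv <;>
    simp only [Bool.and_true, Bool.and_false, Bool.not_true,
      Bool.not_false, Bool.toNat_true, Bool.toNat_false, Nat.add_zero, Nat.zero_add]
      at deg_z deg_u deg_v c_szu c_szv c_stu c_stv c_suv c_ztu c_ztv c_zuv c_tuv <;>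
    omega

set_option maxHeartbeats 4000000 in
-- The same method with `z` tied to `t` instead of `s`, which changes the class bounds of the
-- triples containing `z`.
theorem RepFree.not_twin_window_one (hG : G.RepFree) {z s t u v : V} (hzs : z ≠ s) (hzt : z ≠ t)
    (hzu : z ≠ u) (hzv : z ≠ v) (hst : s ≠ t) (hsu : s ≠ u) (hsv : s ≠ v) (htu : t ≠ u)
    (htv : t ≠ v) (huv : u ≠ v) (hN : G.NearTwin s t z) (dt : G.degree t = G.degree s + 1)
    (dz : G.degree z = G.degree s + 1) (du : G.degree u = G.degree s + 3)
    (dv : G.degree v = G.degree s + 3) : False := by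
  obtain ⟨hzt', hzs', hst'⟩ := hN
  obtain ⟨O, hO⟩ : ∃ O, O = ({z, s, t, u, v} : Finset V)ᶜ := ⟨_, rfl⟩
  have hmem : ∀ w ∈ O, w ≠ z ∧ w ≠ s ∧ w ≠ t ∧ w ≠ u ∧ w ≠ v := by
    intro w hw
    rw [hO] at hw
    simpa only [Finset.mem_compl, Finset.mem_insert, Finset.mem_singleton, not_or] using hw
  have ht : ∀ w ∈ O, decide (G.Adj t w) = decide (G.Adj s w) := by
    intro w hw
    obtain ⟨w1, w2, w3, -, -⟩ := hmem w hw
    have := hst' w w2 w3 w1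
    simp only [G.adj_comm w] at this
    simp only [this]
  have deg_z := degree_eq_add_card_filter (G := G) hzs hzt hzu hzv hst hsu hsv htu htv huv z
  rw [← hO, card_filter_comp O (G.signature z s u v) (G.Adj z) (fun k => k.1)
    (by simp [signature])] at deg_z
  have deg_s := degree_eq_add_card_filter (G := G) hzs hzt hzu hzv hst hsu hsv htu htv huv s
  rw [← hO, card_filter_comp O (G.signature z s u v) (G.Adj s) (fun k => k.2.1)
    (by simp [signature])] at deg_s
  have deg_u := degree_eq_add_card_filter (G := G) hzs hzt hzu hzv hst hsu hsv htu htv huv u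
  rw [← hO, card_filter_comp O (G.signature z s u v) (G.Adj u) (fun k => k.2.2.1)
    (by simp [signature])] at deg_u
  have deg_v := degree_eq_add_card_filter (G := G) hzs hzt hzu hzv hst hsu hsv htu htv huv v
  rw [← hO, card_filter_comp O (G.signature z s u v) (G.Adj v) (fun k => k.2.2.2)
    (by simp [signature])] at deg_v
  have c_stu := hG.card_patternClass_one_two hst hsu htu (by omega) (by omega)
  have stu_A := sum_add_le_card_patternClass (G := G) (z := z) (s := s) (u := u) (v := v)
    (a := s) (b := t) (c := u) (d := z) (e := v) O (by grind) hzs hzt hzu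
    hsv.symm htv.symm huv.symm hzv false false true
      (fun k => k.2.1 == false && k.2.1 == false && k.2.2.1 == true)
    (by intro w hw; simp only [hasPattern, signature, ht w hw])
  have stu_B := sum_add_le_card_patternClass (G := G) (z := z) (s := s) (u := u) (v := v)
    (a := s) (b := t) (c := u) (d := z) (e := v) O (by grind) hzs hzt hzu
    hsv.symm htv.symm huv.symm hzv false true true
      (fun k => k.2.1 == false && k.2.1 == true && k.2.2.1 == true)
    (by intro w hw; simp only [hasPattern, signature, ht w hw])
  have c_stv := hG.card_patternClass_one_two hst hsv htv (by omega) (by omega)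
  have stv_A := sum_add_le_card_patternClass (G := G) (z := z) (s := s) (u := u) (v := v)
    (a := s) (b := t) (c := v) (d := z) (e := u) O (by grind) hzs hzt hzv
    hsu.symm htu.symm huv hzu false false true
      (fun k => k.2.1 == false && k.2.1 == false && k.2.2.2 == true)
    (by intro w hw; simp only [hasPattern, signature, ht w hw])
  have stv_B := sum_add_le_card_patternClass (G := G) (z := z) (s := s) (u := u) (v := v)
    (a := s) (b := t) (c := v) (d := z) (e := u) O (by grind) hzs hzt hzv
    hsu.symm htu.symm huv hzu false true true
      (fun k => k.2.1 == false && k.2.1 == true && k.2.2.2 == true)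
    (by intro w hw; simp only [hasPattern, signature, ht w hw])
  have c_szu := hG.card_patternClass_one_two hzs.symm hsu hzu (by omega) (by omega)
  have szu_A := sum_add_le_card_patternClass (G := G) (z := z) (s := s) (u := u) (v := v)
    (a := s) (b := z) (c := u) (d := t) (e := v) O (by grind) hst.symm hzt.symm htu
    hsv.symm hzv.symm huv.symm htv false false true
      (fun k => k.2.1 == false && k.1 == false && k.2.2.1 == true)
    (by intro w hw; simp only [hasPattern, signature])
  have szu_B := sum_add_le_card_patternClass (G := G) (z := z) (s := s) (u := u) (v := v)
    (a := s) (b := z) (c := u) (d := t) (e := v) O (by grind) hst.symm hzt.symm htu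
    hsv.symm hzv.symm huv.symm htv false true true
      (fun k => k.2.1 == false && k.1 == true && k.2.2.1 == true)
    (by intro w hw; simp only [hasPattern, signature])
  have c_szv := hG.card_patternClass_one_two hzs.symm hsv hzv (by omega) (by omega)
  have szv_A := sum_add_le_card_patternClass (G := G) (z := z) (s := s) (u := u) (v := v)
    (a := s) (b := z) (c := v) (d := t) (e := u) O (by grind) hst.symm hzt.symm htv
    hsu.symm hzu.symm huv htu false false true
      (fun k => k.2.1 == false && k.1 == false && k.2.2.2 == true)
    (by intro w hw; simp only [hasPattern, signature])
  have szv_B := sum_add_le_card_patternClass (G := G) (z := z) (s := s) (u := u) (v := v)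
    (a := s) (b := z) (c := v) (d := t) (e := u) O (by grind) hst.symm hzt.symm htv
    hsu.symm hzu.symm huv htu false true true
      (fun k => k.2.1 == false && k.1 == true && k.2.2.2 == true)
    (by intro w hw; simp only [hasPattern, signature])
  have c_suv := hG.card_patternClass_three_zero hsu hsv huv (by omega) (by omega)
  have suv_B := sum_add_le_card_patternClass (G := G) (z := z) (s := s) (u := u) (v := v)
    (a := s) (b := u) (c := v) (d := z) (e := t) O (by grind) hzs hzu hzv
    hst.symm htu htv hzt false true true (fun k => k.2.1 == false && k.2.2.1 == true && k.2.2.2 ==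
      true)
    (by intro w hw; simp only [hasPattern, signature])
  have c_tzu := hG.card_patternClass_zero_two hzt.symm htu hzu (by omega) (by omega)
  have tzu_A := sum_add_le_card_patternClass (G := G) (z := z) (s := s) (u := u) (v := v)
    (a := t) (b := z) (c := u) (d := s) (e := v) O (by grind) hst hzs.symm hsu
    htv.symm hzv.symm huv.symm hsv false false true
      (fun k => k.2.1 == false && k.1 == false && k.2.2.1 == true)
    (by intro w hw; simp only [hasPattern, signature, ht w hw])
  have tzu_B := sum_add_le_card_patternClass (G := G) (z := z) (s := s) (u := u) (v := v)
    (a := t) (b := z) (c := u) (d := s) (e := v) O (by grind) hst hzs.symm hsu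
    htv.symm hzv.symm huv.symm hsv false true true
      (fun k => k.2.1 == false && k.1 == true && k.2.2.1 == true)
    (by intro w hw; simp only [hasPattern, signature, ht w hw])
  have tzu_D := sum_add_le_card_patternClass (G := G) (z := z) (s := s) (u := u) (v := v)
    (a := t) (b := z) (c := u) (d := s) (e := v) O (by grind) hst hzs.symm hsu
    htv.symm hzv.symm huv.symm hsv true false true
      (fun k => k.2.1 == true && k.1 == false && k.2.2.1 == true)
    (by intro w hw; simp only [hasPattern, signature, ht w hw])
  have c_tzv := hG.card_patternClass_zero_two hzt.symm htv hzv (by omega) (by omega)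
  have tzv_A := sum_add_le_card_patternClass (G := G) (z := z) (s := s) (u := u) (v := v)
    (a := t) (b := z) (c := v) (d := s) (e := u) O (by grind) hst hzs.symm hsv
    htu.symm hzu.symm huv hsu false false true
      (fun k => k.2.1 == false && k.1 == false && k.2.2.2 == true)
    (by intro w hw; simp only [hasPattern, signature, ht w hw])
  have tzv_B := sum_add_le_card_patternClass (G := G) (z := z) (s := s) (u := u) (v := v)
    (a := t) (b := z) (c := v) (d := s) (e := u) O (by grind) hst hzs.symm hsv
    htu.symm hzu.symm huv hsu false true true
      (fun k => k.2.1 == false && k.1 == true && k.2.2.2 == true)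
    (by intro w hw; simp only [hasPattern, signature, ht w hw])
  have tzv_D := sum_add_le_card_patternClass (G := G) (z := z) (s := s) (u := u) (v := v)
    (a := t) (b := z) (c := v) (d := s) (e := u) O (by grind) hst hzs.symm hsv
    htu.symm hzu.symm huv hsu true false true
      (fun k => k.2.1 == true && k.1 == false && k.2.2.2 == true)
    (by intro w hw; simp only [hasPattern, signature, ht w hw])
  have c_tuv := hG.card_patternClass_two_zero htu htv huv (by omega) (by omega)
  have tuv_A := sum_add_le_card_patternClass (G := G) (z := z) (s := s) (u := u) (v := v)
    (a := t) (b := u) (c := v) (d := z) (e := s) O (by grind) hzt hzu hzv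
    hst hsu hsv hzs false false true (fun k => k.2.1 == false && k.2.2.1 == false && k.2.2.2 ==
      true)
    (by intro w hw; simp only [hasPattern, signature, ht w hw])
  have tuv_B := sum_add_le_card_patternClass (G := G) (z := z) (s := s) (u := u) (v := v)
    (a := t) (b := u) (c := v) (d := z) (e := s) O (by grind) hzt hzu hzv
    hst hsu hsv hzs false true true (fun k => k.2.1 == false && k.2.2.1 == true && k.2.2.2 == true)
    (by intro w hw; simp only [hasPattern, signature, ht w hw])
  have tuv_C := sum_add_le_card_patternClass (G := G) (z := z) (s := s) (u := u) (v := v)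
    (a := t) (b := u) (c := v) (d := z) (e := s) O (by grind) hzt hzu hzv
    hst hsu hsv hzs false true false (fun k => k.2.1 == false && k.2.2.1 == true && k.2.2.2 ==
      false)
    (by intro w hw; simp only [hasPattern, signature, ht w hw])
  have c_zuv := hG.card_patternClass_two_zero hzu hzv huv (by omega) (by omega)
  have zuv_A := sum_add_le_card_patternClass (G := G) (z := z) (s := s) (u := u) (v := v)
    (a := z) (b := u) (c := v) (d := s) (e := t) O (by grind) hzs.symm hsu hsv
    hzt.symm htu htv hst false false true
      (fun k => k.1 == false && k.2.2.1 == false && k.2.2.2 == true)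
    (by intro w hw; simp only [hasPattern, signature])
  have zuv_B := sum_add_le_card_patternClass (G := G) (z := z) (s := s) (u := u) (v := v)
    (a := z) (b := u) (c := v) (d := s) (e := t) O (by grind) hzs.symm hsu hsv
    hzt.symm htu htv hst false true true (fun k => k.1 == false && k.2.2.1 == true && k.2.2.2 ==
      true)
    (by intro w hw; simp only [hasPattern, signature])
  have zuv_C := sum_add_le_card_patternClass (G := G) (z := z) (s := s) (u := u) (v := v)
    (a := z) (b := u) (c := v) (d := s) (e := t) O (by grind) hzs.symm hsu hsv
    hzt.symm htu htv hst false true false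
      (fun k => k.1 == false && k.2.2.1 == true && k.2.2.2 == false)
    (by intro w hw; simp only [hasPattern, signature])
  generalize hT : (fun k => (O.filter fun w => G.signature z s u v w = k).card) = T
  have hT' : ∀ k, (O.filter fun w => G.signature z s u v w = k).card = T k := fun k => by rw [← hT]
  have hu := hst' u hsu.symm htu.symm hzu.symm
  have hv := hst' v hsv.symm htv.symm hzv.symm
  obtain ⟨bzu, h_zu⟩ : ∃ b, b = decide (G.Adj z u) := ⟨_, rfl⟩
  obtain ⟨bzv, h_zv⟩ : ∃ b, b = decide (G.Adj z v) := ⟨_, rfl⟩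
  obtain ⟨bst, h_st⟩ : ∃ b, b = decide (G.Adj s t) := ⟨_, rfl⟩
  obtain ⟨bsu, h_su⟩ : ∃ b, b = decide (G.Adj s u) := ⟨_, rfl⟩
  obtain ⟨bsv, h_sv⟩ : ∃ b, b = decide (G.Adj s v) := ⟨_, rfl⟩
  obtain ⟨buv, h_uv⟩ : ∃ b, b = decide (G.Adj u v) := ⟨_, rfl⟩
  have e_zz : decide (G.Adj z z) = false := by simp
  have e_zs : decide (G.Adj z s) = false := by simp [hzs']
  have e_zt : decide (G.Adj z t) = true := by simp [hzt']
  have e_zu : decide (G.Adj z u) = bzu := by grind [G.adj_comm]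
  have e_zv : decide (G.Adj z v) = bzv := by grind [G.adj_comm]
  have e_sz : decide (G.Adj s z) = false := by simp [hzs', G.adj_comm]
  have e_ss : decide (G.Adj s s) = false := by simp
  have e_st : decide (G.Adj s t) = bst := by grind [G.adj_comm]
  have e_su : decide (G.Adj s u) = bsu := by grind [G.adj_comm]
  have e_sv : decide (G.Adj s v) = bsv := by grind [G.adj_comm]
  have e_tz : decide (G.Adj t z) = true := by simp [hzt', G.adj_comm]
  have e_ts : decide (G.Adj t s) = bst := by grind [G.adj_comm]
  have e_tt : decide (G.Adj t t) = false := by simp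
  have e_tu : decide (G.Adj t u) = bsu := by grind [G.adj_comm]
  have e_tv : decide (G.Adj t v) = bsv := by grind [G.adj_comm]
  have e_uz : decide (G.Adj u z) = bzu := by grind [G.adj_comm]
  have e_us : decide (G.Adj u s) = bsu := by grind [G.adj_comm]
  have e_ut : decide (G.Adj u t) = bsu := by grind [G.adj_comm]
  have e_uu : decide (G.Adj u u) = false := by simp
  have e_uv : decide (G.Adj u v) = buv := by grind [G.adj_comm]
  have e_vz : decide (G.Adj v z) = bzv := by grind [G.adj_comm]
  have e_vs : decide (G.Adj v s) = bsv := by grind [G.adj_comm]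
  have e_vt : decide (G.Adj v t) = bsv := by grind [G.adj_comm]
  have e_vu : decide (G.Adj v u) = buv := by grind [G.adj_comm]
  have e_vv : decide (G.Adj v v) = false := by simp
  simp only [hasPattern, adjNat_eq_toNat, e_zz, e_zs, e_zt, e_zu, e_zv, e_sz, e_ss, e_st, e_su,
    e_sv, e_tz, e_ts, e_tu, e_tv, e_uz, e_us, e_ut, e_uu, e_uv, e_vz, e_vs, e_vt, e_vu, e_vv, hT',
    Fintype.sum_prod_type, Fintype.sum_bool]
    at deg_z deg_s deg_u deg_v stu_A stu_B stv_A stv_B szu_A szu_B szv_A szv_B suv_B tzu_A tzu_B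
      tzu_D tzv_A tzv_B tzv_D tuv_A tuv_B tuv_C zuv_A zuv_B zuv_C
  clear h_zu h_zv h_st h_su h_sv h_uv e_zz e_zs e_zt e_zu e_zv e_sz e_ss e_st e_su e_sv e_tz e_ts
    e_tt e_tu e_tv e_uz e_us e_ut e_uu e_uv e_vz e_vs e_vt e_vu e_vv
  rw [du, deg_s] at deg_u
  rw [dv, deg_s] at deg_v
  rw [dz, deg_s] at deg_z
  -- The class bounds pass to the sums of type counts below them, so that no class remains in the
  -- system.
  replace c_stu := c_stu.imp stu_A.trans stu_B.trans
  replace c_stv := c_stv.imp stv_A.trans stv_B.trans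
  replace c_szu := c_szu.imp szu_A.trans szu_B.trans
  replace c_szv := c_szv.imp szv_A.trans szv_B.trans
  replace c_suv := suv_B.trans c_suv
  replace c_tzu := c_tzu.imp tzu_A.trans
    (Or.imp tzu_A.trans (Or.imp tzu_B.trans tzu_D.trans))
  replace c_tzv := c_tzv.imp tzv_A.trans
    (Or.imp tzv_A.trans (Or.imp tzv_B.trans tzv_D.trans))
  replace c_tuv := c_tuv.imp tuv_B.trans
    (Or.imp tuv_A.trans (Or.imp tuv_B.trans tuv_C.trans))
  replace c_zuv := c_zuv.imp zuv_B.trans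
    (Or.imp zuv_A.trans (Or.imp zuv_B.trans zuv_C.trans))
  clear deg_s stu_A stu_B stv_A stv_B szu_A szu_B szv_A szv_B suv_B tzu_A tzu_B tzu_D tzv_A tzv_B
    tzv_D tuv_A tuv_B tuv_C zuv_A zuv_B zuv_C
  clear hT hT' ht hmem hO hst' hG dt dz du dv hu hv hzt' hzs'
  simp only [cond_true, cond_false, Bool.and_true, Bool.and_false, Bool.true_and, Bool.false_and,
    beq_true_eq, beq_false_eq, Bool.not_true, Bool.not_false,
    Bool.toNat_true, Bool.toNat_false, Nat.add_zero, Nat.zero_add]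
    at deg_z deg_u deg_v c_stu c_stv c_szu c_szv c_suv c_tzu c_tzv c_tuv c_zuv
  cases bzu <;> cases bzv <;> cases bst <;> cases bsu <;> cases bsv <;> cases buv <;>
    simp only [Bool.and_true, Bool.and_false, Bool.not_true,
      Bool.not_false, Bool.toNat_true, Bool.toNat_false, Nat.add_zero, Nat.zero_add]
      at deg_z deg_u deg_v c_stu c_stv c_szu c_szv c_suv c_tzu c_tzv c_tuv c_zuv <;>
    omega

/-! ### The spread of five degrees -/

namespace RepFree

/-- Either of the tied vertices `a, b` may be the near twin of `c`; the other plays the role of `z`.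
-/
theorem not_zero_one_two_zero (hG : G.RepFree) {a b c d e : V} (hab : a ≠ b) (hac : a ≠ c)
    (had : a ≠ d) (hae : a ≠ e) (hbc : b ≠ c) (hbd : b ≠ d) (hbe : b ≠ e) (hcd : c ≠ d)
    (hce : c ≠ e) (hde : d ≠ e) (h1 : G.degree b = G.degree a)
    (h2 : G.degree c = G.degree b + 1) (h3 : G.degree d = G.degree c + 2)
    (h4 : G.degree e = G.degree d) : False := by
  rcases hG.nearTwin_zero_one hab hac hbc h1.symm h2 with h | h
  · exact hG.not_twin_window_zero hab hac had hae hbc hbd hbe hcd hce hde h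
      (by omega) (by omega) (by omega) (by omega)
  · exact hG.not_twin_window_zero hab.symm hbc hbd hbe hac had hae hcd hce hde h
      (by omega) (by omega) (by omega) (by omega)

theorem not_one_zero_two_zero (hG : G.RepFree) {a b c d e : V} (hab : a ≠ b) (hac : a ≠ c)
    (had : a ≠ d) (hae : a ≠ e) (hbc : b ≠ c) (hbd : b ≠ d) (hbe : b ≠ e) (hcd : c ≠ d)
    (hce : c ≠ e) (hde : d ≠ e) (h1 : G.degree b = G.degree a + 1)
    (h2 : G.degree c = G.degree b) (h3 : G.degree d = G.degree c + 2)
    (h4 : G.degree e = G.degree d) : False := by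
  rcases hG.nearTwin_one_zero hab hac hbc h1 h2 with h | h
  · exact hG.not_twin_window_one hac.symm hbc.symm hcd hce hab had hae hbd hbe hde h
      (by omega) (by omega) (by omega) (by omega)
  · exact hG.not_twin_window_one hab.symm hbc hbd hbe hac had hae hcd hce hde h
      (by omega) (by omega) (by omega) (by omega)

/-- The degrees of five vertices spread over more than three. -/
theorem add_three_lt_degree (hG : G.RepFree) {a b c d e : V} (hab : a ≠ b) (hac : a ≠ c)
    (had : a ≠ d) (hae : a ≠ e) (hbc : b ≠ c) (hbd : b ≠ d) (hbe : b ≠ e) (hcd : c ≠ d)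
    (hce : c ≠ e) (hde : d ≠ e) (h1 : G.degree a ≤ G.degree b) (h2 : G.degree b ≤ G.degree c)
    (h3 : G.degree c ≤ G.degree d) (h4 : G.degree d ≤ G.degree e) :
    G.degree a + 3 < G.degree e := by
  by_contra! h5
  -- Complementation keeps the gaps and reverses their order, so `n11` to `n14` are mirror images of
  -- excluded sequences.
  have hd : ∀ {x y k}, G.degree y = G.degree x + k → Gᶜ.degree x = Gᶜ.degree y + k := by
    intro x y k h
    have h1 := G.degree_lt_card_verts x
    have h2 := G.degree_lt_card_verts y
    rw [degree_compl, degree_compl]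
    omega
  have n11 : ¬ (G.degree b = G.degree a + 1 ∧ G.degree c = G.degree b + 1 ∧
      G.degree d = G.degree c + 1 ∧ G.degree e = G.degree d) := fun h =>
    hG.compl.not_zero_one_one_one hde.symm hce.symm hbe.symm hae.symm hcd.symm hbd.symm had.symm
      hbc.symm hac.symm hab.symm (hd (k := 0) h.2.2.2) (hd h.2.2.1) (hd h.2.1) (hd h.1)
  have n12 : ¬ (G.degree b = G.degree a + 2 ∧ G.degree c = G.degree b ∧
      G.degree d = G.degree c + 1 ∧ G.degree e = G.degree d) := fun h =>
    hG.compl.not_zero_one_zero_two hde.symm hce.symm hbe.symm hae.symm hcd.symm hbd.symm had.symm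
      hbc.symm hac.symm hab.symm (hd (k := 0) h.2.2.2) (hd h.2.2.1) (hd (k := 0) h.2.1) (hd h.1)
  have n13 : ¬ (G.degree b = G.degree a ∧ G.degree c = G.degree b + 2 ∧
      G.degree d = G.degree c + 1 ∧ G.degree e = G.degree d) := fun h =>
    hG.compl.not_zero_one_two_zero hde.symm hce.symm hbe.symm hae.symm hcd.symm hbd.symm had.symm
      hbc.symm hac.symm hab.symm (hd (k := 0) h.2.2.2) (hd h.2.2.1) (hd h.2.1) (hd (k := 0) h.1)
  have n14 : ¬ (G.degree b = G.degree a ∧ G.degree c = G.degree b + 2 ∧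
      G.degree d = G.degree c ∧ G.degree e = G.degree d + 1) := fun h =>
    hG.compl.not_one_zero_two_zero hde.symm hce.symm hbe.symm hae.symm hcd.symm hbd.symm had.symm
      hbc.symm hac.symm hab.symm (hd h.2.2.2) (hd (k := 0) h.2.2.1) (hd h.2.1) (hd (k := 0) h.1)
  have n1 : ¬ (G.degree a = G.degree b ∧ G.degree b = G.degree c) :=
    fun h => hG.not_zero hab hac hbc h.1 h.2
  have n2 : ¬ (G.degree b = G.degree c ∧ G.degree c = G.degree d) :=
    fun h => hG.not_zero hbc hbd hcd h.1 h.2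
  have n3 : ¬ (G.degree c = G.degree d ∧ G.degree d = G.degree e) :=
    fun h => hG.not_zero hcd hce hde h.1 h.2
  have n4 : ¬ (G.degree b = G.degree a + 1 ∧ G.degree c = G.degree b ∧
      G.degree d = G.degree c + 1) :=
    fun h => hG.not_one_zero_one hab hac hbc hbd hcd h.1 h.2.1 h.2.2
  have n5 : ¬ (G.degree c = G.degree b + 1 ∧ G.degree d = G.degree c ∧
      G.degree e = G.degree d + 1) :=
    fun h => hG.not_one_zero_one hbc hbd hcd hce hde h.1 h.2.1 h.2.2
  have n6 : ¬ (G.degree b = G.degree a ∧ G.degree c = G.degree b + 1 ∧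
      G.degree d = G.degree c + 1 ∧ G.degree e = G.degree d) := fun h =>
    hG.not_zero_one_one_zero hab hac had hae hbc hbd hbe hcd hce hde h.1 h.2.1 h.2.2.1 h.2.2.2
  have n7 : ¬ (G.degree b = G.degree a ∧ G.degree c = G.degree b + 1 ∧
      G.degree d = G.degree c + 1 ∧ G.degree e = G.degree d + 1) := fun h =>
    hG.not_zero_one_one_one hab hac had hae hbc hbd hbe hcd hce hde h.1 h.2.1 h.2.2.1 h.2.2.2
  have n8 : ¬ (G.degree b = G.degree a ∧ G.degree c = G.degree b + 1 ∧
      G.degree d = G.degree c ∧ G.degree e = G.degree d + 2) := fun h =>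
    hG.not_zero_one_zero_two hab hac had hae hbc hbd hbe hcd hce hde h.1 h.2.1 h.2.2.1 h.2.2.2
  have n9 : ¬ (G.degree b = G.degree a ∧ G.degree c = G.degree b + 1 ∧
      G.degree d = G.degree c + 2 ∧ G.degree e = G.degree d) := fun h =>
    hG.not_zero_one_two_zero hab hac had hae hbc hbd hbe hcd hce hde h.1 h.2.1 h.2.2.1 h.2.2.2
  have n10 : ¬ (G.degree b = G.degree a + 1 ∧ G.degree c = G.degree b ∧
      G.degree d = G.degree c + 2 ∧ G.degree e = G.degree d) := fun h =>
    hG.not_one_zero_two_zero hab hac had hae hbc hbd hbe hcd hce hde h.1 h.2.1 h.2.2.1 h.2.2.2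
  clear hd
  generalize G.degree a = da, G.degree b = db, G.degree c = dc, G.degree d = dd,
    G.degree e = de at *
  -- Every sequence of gaps `p, q, r, t` with sum at most three contains an excluded block.
  obtain ⟨p, rfl⟩ := Nat.exists_eq_add_of_le h1
  obtain ⟨q, rfl⟩ := Nat.exists_eq_add_of_le h2
  obtain ⟨r, rfl⟩ := Nat.exists_eq_add_of_le h3
  obtain ⟨t, rfl⟩ := Nat.exists_eq_add_of_le h4
  have hp : p ≤ 3 := by omega
  have hq : q ≤ 3 - p := by omega
  have hr : r ≤ 3 - p - q := by omega
  have ht : t ≤ 3 - p - q - r := by omega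
  interval_cases p <;> interval_cases q <;> interval_cases r <;> interval_cases t <;>
    first
    | exact n1 ⟨rfl, rfl⟩
    | exact n2 ⟨rfl, rfl⟩
    | exact n3 ⟨rfl, rfl⟩
    | exact n4 ⟨rfl, rfl, rfl⟩
    | exact n5 ⟨rfl, rfl, rfl⟩
    | exact n6 ⟨rfl, rfl, rfl, rfl⟩
    | exact n7 ⟨rfl, rfl, rfl, rfl⟩
    | exact n8 ⟨rfl, rfl, rfl, rfl⟩
    | exact n9 ⟨rfl, rfl, rfl, rfl⟩
    | exact n10 ⟨rfl, rfl, rfl, rfl⟩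
    | exact n11 ⟨rfl, rfl, rfl, rfl⟩
    | exact n12 ⟨rfl, rfl, rfl, rfl⟩
    | exact n13 ⟨rfl, rfl, rfl, rfl⟩
    | exact n14 ⟨rfl, rfl, rfl, rfl⟩

end RepFree

/-! ### Degree orders and extreme degrees -/

variable (G) in
/-- `w 0, …, w (n - 1)` are the `n` vertices in the order of their degrees. -/
def IsDegreeOrder (w : ℕ → V) : Prop :=
  (∀ i j, i < Fintype.card V → j < Fintype.card V → i ≠ j → w i ≠ w j) ∧
    ∀ i j, i ≤ j → j < Fintype.card V → G.degree (w i) ≤ G.degree (w j)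

variable (G) in
theorem exists_isDegreeOrder (h : 0 < Fintype.card V) : ∃ w, G.IsDegreeOrder w := by
  let e := (Fintype.equivFin V).symm
  let σ := Tuple.sort fun i => G.degree (e i)
  have hσ : Monotone fun i => G.degree (e (σ i)) := Tuple.monotone_sort fun i => G.degree (e i)
  -- Reducing the index modulo the number of vertices only supplies irrelevant values beyond the
  -- range.
  refine ⟨fun i => e (σ ⟨i % Fintype.card V, Nat.mod_lt _ h⟩), fun i j hi hj hij he => hij ?_,
    fun i j hij hj => hσ ?_⟩
  · have := σ.injective (e.injective he)
    simpa [Nat.mod_eq_of_lt hi, Nat.mod_eq_of_lt hj] using this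
  · simpa [Nat.mod_eq_of_lt hj, Nat.mod_eq_of_lt (hij.trans_lt hj)] using hij

theorem IsDegreeOrder.compl {w : ℕ → V} (hw : G.IsDegreeOrder w) :
    Gᶜ.IsDegreeOrder fun i => w (Fintype.card V - 1 - i) := by
  refine ⟨fun i j hi hj hij => hw.1 _ _ (by omega) (by omega) (by omega), fun i j hij hj => ?_⟩
  have := hw.2 (Fintype.card V - 1 - j) (Fintype.card V - 1 - i) (by omega) (by omega)
  simp only [degree_compl]
  omega

theorem eq_of_degree_eq_one {x y z : V} (h : G.degree x = 1) (hy : G.Adj x y) (hz : G.Adj x z) :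
    y = z := by
  obtain ⟨u, hu⟩ := Finset.card_eq_one.1 ((G.card_neighborFinset_eq_degree x).trans h)
  have h1 : y ∈ G.neighborFinset x := by simpa using hy
  have h2 : z ∈ G.neighborFinset x := by simpa using hz
  rw [hu, Finset.mem_singleton] at h1 h2
  rw [h1, h2]

theorem not_adj_of_degree_eq_zero {x : V} (h : G.degree x = 0) (y : V) : ¬ G.Adj x y := by
  intro hy
  have := (G.degree_pos_iff_exists_adj x).2 ⟨y, hy⟩
  omega

theorem adj_of_degree_add_one {x y : V} (h : G.degree x + 1 = Fintype.card V) (hxy : x ≠ y) :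
    G.Adj x y := by
  by_contra hn
  refine not_adj_of_degree_eq_zero (G := Gᶜ) (x := x) ?_ y (by simp [compl_adj, hxy, hn])
  rw [degree_compl]
  omega

theorem eq_of_degree_add_two {x y z : V} (h : G.degree x + 2 = Fintype.card V) (hy : x ≠ y)
    (hz : x ≠ z) (hxy : ¬ G.Adj x y) (hxz : ¬ G.Adj x z) : y = z := by
  refine eq_of_degree_eq_one (G := Gᶜ) (x := x) ?_ (by simp [compl_adj, hy, hxy])
    (by simp [compl_adj, hz, hxz])
  rw [degree_compl]
  omega

/-! ### Counting along the degree order -/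

namespace RepFree

theorem degree_lt_add_two (hG : G.RepFree) {w : ℕ → V} (hw : G.IsDegreeOrder w) {i : ℕ}
    (hi : i + 2 < Fintype.card V) : G.degree (w i) < G.degree (w (i + 2)) := by
  have h1 := hw.2 i (i + 1) (by omega) (by omega)
  have h2 := hw.2 (i + 1) (i + 2) (by omega) (by omega)
  by_contra! h
  exact hG.not_zero (hw.1 i (i + 1) (by omega) (by omega) (by omega))
    (hw.1 i (i + 2) (by omega) (by omega) (by omega))
    (hw.1 (i + 1) (i + 2) (by omega) (by omega) (by omega)) (by omega) (by omega)

/-- Five consecutive vertices spread over at least four degrees; this is iterated. The end index is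
a variable so that it may be given in any form. -/
theorem degree_add_four_mul_le (hG : G.RepFree) {w : ℕ → V} (hw : G.IsDegreeOrder w) {i k j : ℕ}
    (hj : j = i + 4 * k) (hi : j < Fintype.card V) :
    G.degree (w i) + 4 * k ≤ G.degree (w j) := by
  subst hj
  induction k with
  | zero => simp
  | succ k ih =>
    have ih := ih (by omega)
    obtain ⟨j, hj⟩ : ∃ j, j = i + 4 * k := ⟨_, rfl⟩
    rw [show i + 4 * (k + 1) = j + 4 by omega] at hi ⊢
    rw [← hj] at ih
    have ne : ∀ p q, p ≤ 4 → q ≤ 4 → p ≠ q → w (j + p) ≠ w (j + q) := fun p q hp hq hpq =>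
      hw.1 _ _ (by omega) (by omega) (by omega)
    have : G.degree (w j) + 3 < G.degree (w (j + 4)) := hG.add_three_lt_degree
      (a := w (j + 0)) (b := w (j + 1)) (c := w (j + 2)) (d := w (j + 3)) (e := w (j + 4)) (ne _ _
        (by omega) (by omega) (by omega))
      (ne _ _ (by omega) (by omega) (by omega)) (ne _ _ (by omega) (by omega) (by omega))
      (ne _ _ (by omega) (by omega) (by omega)) (ne _ _ (by omega) (by omega) (by omega))
      (ne _ _ (by omega) (by omega) (by omega)) (ne _ _ (by omega) (by omega) (by omega))
      (ne _ _ (by omega) (by omega) (by omega)) (ne _ _ (by omega) (by omega) (by omega))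
      (ne _ _ (by omega) (by omega) (by omega)) (hw.2 _ _ (by omega) (by omega))
      (hw.2 _ _ (by omega) (by omega)) (hw.2 _ _ (by omega) (by omega))
      (hw.2 _ _ (by omega) (by omega))
    omega

/-- If the lowest degrees are `1, 1, 2` and some vertex is adjacent to all others, then the fourth
lowest degree is at least `4`. -/
theorem three_lt_degree (hG : G.RepFree) {w : ℕ → V} (hw : G.IsDegreeOrder w)
    (hn : 4 < Fintype.card V) (h0 : G.degree (w 0) = 1) (h1 : G.degree (w 1) = 1)
    (h2 : G.degree (w 2) = 2)
    (htop : G.degree (w (Fintype.card V - 1)) + 1 = Fintype.card V) : 3 < G.degree (w 3) := by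
  have ne : ∀ p q, p ≤ 3 → q ≤ 3 → p ≠ q → w p ≠ w q := fun p q hp hq hpq =>
    hw.1 _ _ (by omega) (by omega) (by omega)
  have h01 := ne 0 1 (by omega) (by omega) (by omega)
  have h02 := ne 0 2 (by omega) (by omega) (by omega)
  have h03 := ne 0 3 (by omega) (by omega) (by omega)
  have h12 := ne 1 2 (by omega) (by omega) (by omega)
  have h13 := ne 1 3 (by omega) (by omega) (by omega)
  have h23 := ne 2 3 (by omega) (by omega) (by omega)
  have h3 := hw.2 2 3 (by omega) (by omega)
  have hadj : G.Adj (w 0) (w (Fintype.card V - 1)) :=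
    (adj_of_degree_add_one htop (hw.1 _ _ (by omega) (by omega) (by omega))).symm
  -- The only neighbour of the pendant vertex `w 0` is the dominating one, whereas a fourth degree
  -- of 2 or 3 would give it a neighbour among the lowest four.
  have hno : ∀ p, p ≤ 3 → ¬ G.Adj (w 0) (w p) := fun p hp h =>
    hw.1 p (Fintype.card V - 1) (by omega) (by omega) (by omega) (eq_of_degree_eq_one h0 h hadj)
  have n2 := hno 2 (by omega)
  have n3 := hno 3 (by omega)
  by_contra! hle
  rcases (show G.degree (w 3) = 2 ∨ G.degree (w 3) = 3 by omega) with h | h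
  · obtain ⟨-, -, h | h⟩ := hG.zero_one_zero h01 h02 h03 h12 h13 h23 (by omega) (by omega)
      (by omega)
    · exact n3 h.1
    · exact n2 h.1
  · obtain ⟨-, -, h | h⟩ := hG.zero_one_one h01 h02 h03 h12 h13 h23 (by omega) (by omega)
      (by omega)
    · exact n3 h.1
    · exact n2 h.1

/-- A pendant vertex allows only one dominating vertex. Steps of four down from the two highest
vertices then bound the lowest degrees tightly. -/
theorem false_of_degree_zero_eq_one (hG : G.RepFree) {w : ℕ → V} (hw : G.IsDegreeOrder w)
    {m : ℕ} (hm : 1 ≤ m) (hn : Fintype.card V = 4 * m + 3 ∨ Fintype.card V = 4 * m + 4)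
    (h0 : G.degree (w 0) = 1)
    (htop : G.degree (w (Fintype.card V - 1)) + 1 = Fintype.card V) : False := by
  have hpen : G.degree (w (Fintype.card V - 2)) + 1 ≠ Fintype.card V := by
    intro h
    refine hw.1 (Fintype.card V - 1) (Fintype.card V - 2) (by omega) (by omega) (by omega)
      (eq_of_degree_eq_one h0 (adj_of_degree_add_one htop ?_).symm
        (adj_of_degree_add_one h ?_).symm) <;>
    exact hw.1 _ _ (by omega) (by omega) (by omega)
  have hpen' := G.degree_lt_card_verts (w (Fintype.card V - 2))
  have d02 : G.degree (w 0) < G.degree (w 2) := hG.degree_lt_add_two hw (by omega)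
  have d01 := hw.2 0 1 (by omega) (by omega)
  have d12 := hw.2 1 2 (by omega) (by omega)
  have d23 := hw.2 2 3 (by omega) (by omega)
  rcases hn with hn | hn
  · rw [show Fintype.card V - 1 = 4 * m + 2 by omega] at htop
    rw [show Fintype.card V - 2 = 4 * m + 1 by omega] at hpen hpen'
    have c2 := hG.degree_add_four_mul_le hw (i := 2) (k := m) (j := 4 * m + 2) (by omega) (by omega)
    have c1 := hG.degree_add_four_mul_le hw (i := 1) (k := m) (j := 4 * m + 1) (by omega) (by omega)
    have c0 := hG.degree_add_four_mul_le hw (i := 0) (k := m) (j := 4 * m) (by omega) (by omega)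
    have c3 := hG.degree_add_four_mul_le hw (i := 3) (k := m - 1) (j := 4 * m - 1) (by omega)
      (by omega)
    -- The lowest degrees are 1, 1, 2. The next is thus at least 4, which lifts `w (4 * m - 1)` to
    -- degree at least 4m.
    have h3 := hG.three_lt_degree hw (by omega) h0 (by omega) (by omega)
      (by rw [show Fintype.card V - 1 = 4 * m + 2 by omega]; exact htop)
    have e1 := hw.2 (4 * m - 1) (4 * m) (by omega) (by omega)
    have e2 := hw.2 (4 * m) (4 * m + 1) (by omega) (by omega)
    have ne1 := hw.1 (4 * m - 1) (4 * m) (by omega) (by omega) (by omega)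
    have ne2 := hw.1 (4 * m - 1) (4 * m + 1) (by omega) (by omega) (by omega)
    have ne3 := hw.1 (4 * m) (4 * m + 1) (by omega) (by omega) (by omega)
    have ne4 := hw.1 (4 * m) (4 * m + 2) (by omega) (by omega) (by omega)
    have ne5 := hw.1 (4 * m + 1) (4 * m + 2) (by omega) (by omega) (by omega)
    -- The last three degrees are 4m + 1, 4m + 1, 4m + 2, and the one before them is 4m + 1 or 4m.
    by_cases h : G.degree (w (4 * m - 1)) = G.degree (w (4 * m))
    · exact hG.not_zero ne1 ne2 ne3 h (by omega)
    · exact hG.not_one_zero_one ne1 ne2 ne3 ne4 ne5 (by omega) (by omega) (by omega)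
  · rw [show Fintype.card V - 1 = 4 * m + 3 by omega] at htop
    rw [show Fintype.card V - 2 = 4 * m + 2 by omega] at hpen hpen'
    have c2 := hG.degree_add_four_mul_le hw (i := 2) (k := m) (j := 4 * m + 2) (by omega) (by omega)
    have c3 := hG.degree_add_four_mul_le hw (i := 3) (k := m) (j := 4 * m + 3) (by omega) (by omega)
    -- Here `w 2` has degree 2 and `w 3` at most 3, so the lowest degrees are 1, 1, 2, 3 or 1, 2, 2,
    -- 3.
    by_cases h1 : G.degree (w 1) = 1
    · have h3 := hG.three_lt_degree hw (by omega) h0 h1 (by omega)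
        (by rw [show Fintype.card V - 1 = 4 * m + 3 by omega]; exact htop)
      omega
    · have d13 : G.degree (w 1) < G.degree (w 3) := hG.degree_lt_add_two hw (by omega)
      exact hG.not_one_zero_one (hw.1 0 1 (by omega) (by omega) (by omega))
        (hw.1 0 2 (by omega) (by omega) (by omega)) (hw.1 1 2 (by omega) (by omega) (by omega))
        (hw.1 1 3 (by omega) (by omega) (by omega)) (hw.1 2 3 (by omega) (by omega) (by omega))
        (by omega) (by omega) (by omega)

/-- For n = 4m + r with r = 1, 2, 3, 4 the degrees spread over at least n - 1, n - 2, n - 2, n - 3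
respectively, and 0 excludes n - 1. -/
theorem card_lt_five (hG : G.RepFree) : Fintype.card V < 5 := by
  by_contra! hn
  obtain ⟨w, hw⟩ := G.exists_isDegreeOrder (by omega)
  have hlt : ∀ i, G.degree (w i) < Fintype.card V := fun i => G.degree_lt_card_verts (w i)
  have hrange : ∀ i j, i < Fintype.card V → j < Fintype.card V → i ≠ j → G.degree (w i) = 0 →
      G.degree (w j) + 1 ≠ Fintype.card V := fun i j hi hj hij h0 h =>
    not_adj_of_degree_eq_zero h0 _ (adj_of_degree_add_one h (hw.1 j i hj hi hij.symm)).symm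
  -- Extreme degrees 0 and n - 2 mirror 1 and n - 1.
  have hcompl : ∀ m, 1 ≤ m → Fintype.card V = 4 * m + 3 ∨ Fintype.card V = 4 * m + 4 →
      G.degree (w 0) = 0 → G.degree (w (Fintype.card V - 1)) + 2 ≠ Fintype.card V := by
    intro m hm hm' h0 h1
    refine hG.compl.false_of_degree_zero_eq_one hw.compl hm hm' ?_ ?_
    · simp only [degree_compl, Nat.sub_zero]
      omega
    · simp only [degree_compl]
      rw [Nat.sub_self, h0]
      omega
  obtain ⟨m, hm, hcases⟩ : ∃ m, 1 ≤ m ∧ (Fintype.card V = 4 * m + 1 ∨ Fintype.card V = 4 * m + 2 ∨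
      Fintype.card V = 4 * m + 3 ∨ Fintype.card V = 4 * m + 4) :=
    ⟨(Fintype.card V - 1) / 4, by omega, by omega⟩
  have c0 := hG.degree_add_four_mul_le hw (i := 0) (k := m) (j := 4 * m) (by omega) (by omega)
  have d01 := hw.2 0 1 (by omega) (by omega)
  rcases hcases with hc | hc | hc | hc
  · have := hrange 0 (4 * m) (by omega) (by omega) (by omega)
    have := hlt (4 * m)
    omega
  · have c1 := hG.degree_add_four_mul_le hw (i := 1) (k := m) (j := 4 * m + 1) (by omega) (by omega)
    have l1 := hlt (4 * m + 1)
    have r1 := hrange 0 (4 * m + 1) (by omega) (by omega) (by omega)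
    have r2 := hrange 0 (4 * m) (by omega) (by omega) (by omega)
    have l2 := hlt (4 * m)
    have t1 := hw.1 0 (4 * m) (by omega) (by omega) (by omega)
    have t2 := hw.1 0 (4 * m + 1) (by omega) (by omega) (by omega)
    have t3 := hw.1 1 (4 * m) (by omega) (by omega) (by omega)
    -- Either `w (4 * m)` has degree n - 2 and misses two isolated vertices, or `w 0` is pendant and
    -- sees two dominating ones.
    by_cases h0 : G.degree (w 0) = 0
    · refine hw.1 0 1 (by omega) (by omega) (by omega) (eq_of_degree_add_two (G := G)
        (x := w (4 * m)) (by omega) t1.symm t3.symm (fun h => ?_) (fun h => ?_))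
      · exact not_adj_of_degree_eq_zero h0 _ h.symm
      · exact not_adj_of_degree_eq_zero (x := w 1) (by omega) _ h.symm
    · exact hw.1 (4 * m) (4 * m + 1) (by omega) (by omega) (by omega)
        (eq_of_degree_eq_one (G := G) (x := w 0) (by omega)
          (adj_of_degree_add_one (by omega) t1.symm).symm
          (adj_of_degree_add_one (by omega) t2.symm).symm)
  · have c2 := hG.degree_add_four_mul_le hw (i := 2) (k := m) (j := 4 * m + 2) (by omega) (by omega)
    have d02 : G.degree (w 0) < G.degree (w 2) := hG.degree_lt_add_two hw (by omega)
    have l2 := hlt (4 * m + 2)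
    have r1 := hrange 0 (4 * m + 2) (by omega) (by omega) (by omega)
    have hc1 := hcompl m hm (by omega)
    have h1 := hG.false_of_degree_zero_eq_one hw hm (by omega)
    rw [show Fintype.card V - 1 = 4 * m + 2 by omega] at hc1 h1
    by_cases h0 : G.degree (w 0) = 0
    · have := hc1 h0
      have := r1 h0
      omega
    · exact h1 (by omega) (by omega)
  · have c3 := hG.degree_add_four_mul_le hw (i := 3) (k := m) (j := 4 * m + 3) (by omega) (by omega)
    have d02 : G.degree (w 0) < G.degree (w 2) := hG.degree_lt_add_two hw (by omega)
    have d13 : G.degree (w 1) < G.degree (w 3) := hG.degree_lt_add_two hw (by omega)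
    have d23 := hw.2 2 3 (by omega) (by omega)
    have l3 := hlt (4 * m + 3)
    have r1 := hrange 0 (4 * m + 3) (by omega) (by omega) (by omega)
    have hc1 := hcompl m hm (by omega)
    have h1 := hG.false_of_degree_zero_eq_one hw hm (by omega)
    rw [show Fintype.card V - 1 = 4 * m + 3 by omega] at hc1 h1
    -- Larger spreads are excluded. The chains are therefore tight, and the lowest four and the
    -- highest four vertices both have gaps 0, 1, 0.
    have hr : G.degree (w (4 * m + 3)) = G.degree (w 0) + 4 * m + 1 := by
      by_cases h0 : G.degree (w 0) = 0
      · have := hc1 h0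
        have := r1 h0
        omega
      · by_contra
        exact h1 (by omega) (by omega)
    have e02 := hG.degree_lt_add_two hw (i := 4 * m) (by omega)
    have e13 : G.degree (w (4 * m + 1)) < G.degree (w (4 * m + 3)) :=
      hG.degree_lt_add_two hw (by omega)
    have e01 := hw.2 (4 * m) (4 * m + 1) (by omega) (by omega)
    have e12 := hw.2 (4 * m + 1) (4 * m + 2) (by omega) (by omega)
    have e23 := hw.2 (4 * m + 2) (4 * m + 3) (by omega) (by omega)
    have bot := hG.zero_one_zero (hw.1 0 1 (by omega) (by omega) (by omega))
      (hw.1 0 2 (by omega) (by omega) (by omega)) (hw.1 0 3 (by omega) (by omega) (by omega))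
      (hw.1 1 2 (by omega) (by omega) (by omega)) (hw.1 1 3 (by omega) (by omega) (by omega))
      (hw.1 2 3 (by omega) (by omega) (by omega)) (by omega) (by omega) (by omega)
    have top := hG.zero_one_zero
      (hw.1 (4 * m) (4 * m + 1) (by omega) (by omega) (by omega))
      (hw.1 (4 * m) (4 * m + 2) (by omega) (by omega) (by omega))
      (hw.1 (4 * m) (4 * m + 3) (by omega) (by omega) (by omega))
      (hw.1 (4 * m + 1) (4 * m + 2) (by omega) (by omega) (by omega))
      (hw.1 (4 * m + 1) (4 * m + 3) (by omega) (by omega) (by omega))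
      (hw.1 (4 * m + 2) (4 * m + 3) (by omega) (by omega) (by omega))
      (by omega) (by omega) (by omega)
    -- The neighbour `w p` and the non-neighbour `w q` force extreme degrees 1 and n - 2. The top
    -- vertex misses only `w q`, so it sees `w 0`, which then has two neighbours.
    obtain ⟨p, hp, hp'⟩ : ∃ p, p ≤ 3 ∧ G.Adj (w 0) (w p) := by
      rcases bot with ⟨-, -, h | h⟩
      · exact ⟨3, le_rfl, h.1⟩
      · exact ⟨2, by omega, h.1⟩
    obtain ⟨q, hq, hq', hq3⟩ : ∃ q, 4 * m ≤ q ∧ q < 4 * m + 3 ∧ ¬ G.Adj (w (4 * m + 3)) (w q) := by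
      rcases top with ⟨-, -, h | h⟩
      · exact ⟨4 * m + 1, by omega, by omega, fun h' => h.2.2.2.1 h'.symm⟩
      · exact ⟨4 * m, by omega, by omega, fun h' => h.2.2.1 h'.symm⟩
    have h0 : G.degree (w 0) ≠ 0 := fun h => not_adj_of_degree_eq_zero h _ hp'
    have h3 : G.degree (w (4 * m + 3)) + 1 ≠ Fintype.card V := fun h =>
      hq3 (adj_of_degree_add_one h (hw.1 _ _ (by omega) (by omega) (by omega)))
    refine hw.1 0 q (by omega) (by omega) (by omega) (eq_of_degree_add_two (G := G)
      (x := w (4 * m + 3)) (by omega) (hw.1 _ _ (by omega) (by omega) (by omega))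
      (hw.1 _ _ (by omega) (by omega) (by omega)) (fun h => ?_) hq3)
    exact hw.1 p (4 * m + 3) (by omega) (by omega) (by omega)
      (eq_of_degree_eq_one (by omega) hp' h.symm)

end RepFree

/-! ### Repetition numbers of induced subgraphs -/

variable (G)

theorem degree_induce_eq_card_filter (W : Finset V) (a : ((W : Finset V) : Set V))
    [Fintype ((G.induce (W : Set V)).neighborSet a)] :
    (G.induce (W : Set V)).degree a = (W.filter (G.Adj a)).card := by
  rw [← card_neighborFinset_eq_degree]
  refine Finset.card_bij (fun b _ => (b : V)) ?_ ?_ ?_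
  · intro b hb
    rw [mem_neighborFinset] at hb
    exact Finset.mem_filter.2 ⟨b.2, hb⟩
  · intro b _ c _ h
    exact Subtype.ext h
  · intro b hb
    obtain ⟨h1, h2⟩ := Finset.mem_filter.1 hb
    exact ⟨⟨b, h1⟩, by rw [mem_neighborFinset]; exact h2, rfl⟩

theorem three_le_repNumber_induce_iff (W : Finset V) [Fintype (W : Set V)] :
    3 ≤ repNumber (G.induce (W : Set V)) ↔ ∃ a ∈ W, ∃ b ∈ W, ∃ c ∈ W, a ≠ b ∧ a ≠ c ∧ b ≠ c ∧
      (W.filter (G.Adj a)).card = (W.filter (G.Adj b)).card ∧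
      (W.filter (G.Adj b)).card = (W.filter (G.Adj c)).card := by
  unfold repNumber
  rw [← Nat.lt_iff_add_one_le, Finset.lt_sup_iff]
  constructor
  · rintro ⟨v, -, hv⟩
    obtain ⟨a, ha, b, hb, c, hc, hab, hac, hbc⟩ := Finset.two_lt_card.1 hv
    simp only [Finset.mem_filter, Finset.mem_univ, true_and, degree_induce_eq_card_filter]
      at ha hb hc
    exact ⟨a, a.2, b, b.2, c, c.2, fun h => hab (Subtype.ext h), fun h => hac (Subtype.ext h),
      fun h => hbc (Subtype.ext h), ha.trans hb.symm, hb.trans hc.symm⟩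
  · rintro ⟨a, ha, b, hb, c, hc, hab, hac, hbc, h1, h2⟩
    refine ⟨⟨a, ha⟩, Finset.mem_univ _, Finset.two_lt_card.2 ⟨⟨a, ha⟩, ?_, ⟨b, hb⟩, ?_, ⟨c, hc⟩, ?_,
      fun h => hab (congrArg Subtype.val h), fun h => hac (congrArg Subtype.val h),
      fun h => hbc (congrArg Subtype.val h)⟩⟩ <;>
    simp only [Finset.mem_filter, Finset.mem_univ, true_and, degree_induce_eq_card_filter]
    · exact h1.symm
    · exact (h1.trans h2).symm

theorem one_le_repNumber {U : Type*} [Fintype U] [Nonempty U] (H : SimpleGraph U) :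
    1 ≤ repNumber H := by
  classical
  obtain ⟨v⟩ := ‹Nonempty U›
  unfold repNumber
  rw [← Nat.lt_iff_add_one_le, Finset.lt_sup_iff]
  exact ⟨v, Finset.mem_univ v, Finset.card_pos.2 ⟨v, by simp⟩⟩

theorem card_filter_compl_add (D : Finset V) (a : V) :
    (Dᶜ.filter (G.Adj a)).card + (D.filter (G.Adj a)).card = G.degree a := by
  rw [← Finset.card_union_of_disjoint (Finset.disjoint_filter_filter disjoint_compl_left),
    ← Finset.filter_union, Finset.union_comm, Finset.union_compl,
    ← card_neighborFinset_eq_degree, neighborFinset_eq_filter]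

theorem exists_three_le_repNumber (h : 5 ≤ Fintype.card V) :
    ∃ D : Finset V, D.card ≤ 3 ∧ 3 ≤ repNumber (G.induce ((Dᶜ : Finset V) : Set V)) := by
  by_contra! hD
  have hG : G.RepFree := by
    intro D a b c hab hac hbc ha hb hc hcard h1 h2
    have h := hD D hcard
    rw [← not_le, three_le_repNumber_induce_iff] at h
    have ka := G.card_filter_compl_add D a
    have kb := G.card_filter_compl_add D b
    have kc := G.card_filter_compl_add D c
    exact h ⟨a, Finset.mem_compl.2 ha, b, Finset.mem_compl.2 hb, c, Finset.mem_compl.2 hc,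
      hab, hac, hbc, by omega, by omega⟩
  have := hG.card_lt_five
  omega

end SimpleGraph

/-! ### The value of C(3) -/

theorem repeatsAfterDeleting_three_three : RepeatsAfterDeleting 3 3 := by
  classical
  intro n G
  rcases le_or_gt 5 n with h | h
  · obtain ⟨D, hD, hr⟩ := G.exists_three_le_repNumber (by simpa using h)
    refine ⟨Dᶜ, ?_, (min_le_left _ _).trans hr⟩
    rw [Finset.card_compl, Fintype.card_fin]
    omega
  -- With at most four vertices the required repetition n - 3 is at most one, so nothing is deleted.
  · refine ⟨Finset.univ, by simp, ?_⟩
    rcases Nat.lt_or_ge 3 n with h3 | h3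
    · have : Nonempty ((Finset.univ : Finset (Fin n)) : Set (Fin n)) :=
        ⟨⟨⟨0, by omega⟩, by simp⟩⟩
      exact le_trans (by omega) (SimpleGraph.one_le_repNumber _)
    · rw [Nat.sub_eq_zero_of_le h3]
      simp

/-- A graph on eight vertices, as the list of its edges, in which deleting at most two vertices
never leaves three vertices of the same degree. -/
def extremalEdges : List (Fin 8 × Fin 8) :=
  [(0, 1), (0, 2), (0, 3), (0, 4), (0, 6), (0, 7), (1, 2), (1, 3), (1, 4), (1, 5), (1, 7), (2, 3),
    (2, 7), (3, 4)]

/-- The graph with the edges `extremalEdges`. -/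
def extremalGraph : SimpleGraph (Fin 8) where
  Adj a b := (a, b) ∈ extremalEdges ∨ (b, a) ∈ extremalEdges
  symm := ⟨fun _ _ h => h.symm⟩
  loopless := ⟨by decide⟩

instance : DecidableRel extremalGraph.Adj :=
  fun a b => inferInstanceAs (Decidable ((a, b) ∈ extremalEdges ∨ (b, a) ∈ extremalEdges))

/-- Avoiding `repNumber` and bounding `d` makes this a finite check that the kernel can evaluate. -/
theorem extremalGraph_card_le (W : Finset (Fin 8)) (hW : 6 ≤ W.card) :
    ∀ d < 8, (W.filter fun a => (W.filter (extremalGraph.Adj a)).card = d).card ≤ 2 := by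
  have h : ∀ W ∈ Finset.powersetCard 6 (Finset.univ : Finset (Fin 8)) ∪
      Finset.powersetCard 7 Finset.univ ∪ Finset.powersetCard 8 Finset.univ,
      ∀ d < 8, (W.filter fun a => (W.filter (extremalGraph.Adj a)).card = d).card ≤ 2 := by
    decide +kernel
  refine h W ?_
  have : W.card ≤ 8 := by simpa using W.card_le_univ
  simp only [Finset.mem_union, Finset.mem_powersetCard, Finset.subset_univ, true_and]
  omega

theorem three_le_of_repeatsAfterDeleting {c : ℕ} (h : RepeatsAfterDeleting 3 c) : 3 ≤ c := by
  by_contra! hc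
  obtain ⟨W, hW, hr⟩ := h 8 extremalGraph
  rw [min_eq_left (by omega), SimpleGraph.three_le_repNumber_induce_iff] at hr
  obtain ⟨a, ha, b, hb, c, hc, hab, hac, hbc, h1, h2⟩ := hr
  have key := extremalGraph_card_le W (by omega) (W.filter (extremalGraph.Adj a)).card ?_
  · refine absurd (Finset.two_lt_card.2 ⟨a, ?_, b, ?_, c, ?_, hab, hac, hbc⟩) key.not_gt <;>
    simp only [Finset.mem_filter]
    · exact ⟨ha, trivial⟩
    · exact ⟨hb, h1.symm⟩
    · exact ⟨hc, (h1.trans h2).symm⟩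
  -- The bound on `d` holds because `a` is not its own neighbour.
  · refine lt_of_lt_of_le (Finset.card_lt_card (t := Finset.univ) ?_) (by simp)
    rw [Finset.ssubset_univ_iff]
    intro h
    have : a ∈ W.filter (extremalGraph.Adj a) := h ▸ Finset.mem_univ a
    exact extremalGraph.irrefl (Finset.mem_filter.1 this).2

theorem theorem1 :
    (∀ (V : Type*) [Fintype V] [DecidableEq V] (G : SimpleGraph V), 5 ≤ Fintype.card V →
      ∃ D : Finset V, D.card ≤ 3 ∧
        3 ≤ repNumber (G.induce ((Dᶜ : Finset V) : Set V))) ∧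
    IsC 3 3 := by
  classical
  exact ⟨fun V _ _ G h => G.exists_three_le_repNumber h,
    repeatsAfterDeleting_three_three, fun _ h => three_le_of_repeatsAfterDeleting h⟩
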